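/- Let \(P\) be a right Ore monoid: for all \(x_1,x_2\in P\) there are \(y_1,y_2\in P\) with \(x_1y_1=x_2y_2\), and \(xy_1=xy_2\) implies \(y_1z=y_2z\) for some \(z\in P\). Let \(G\) be its group of right fractions \(pq^{-1}\), where \(p_1q_1^{-1}=p_2q_2^{-1}\) if and only if \(p_1t_1=p_2t_2\) and \(q_1t_1=q_2t_2\) for some \(t_1,t_2\in P\). Let \(X\) be a locally compact Hausdorff space with an action of \(P\) by proper topological correspondences: for each \(p\in P\) a locally compact Hausdorff space \(M_p\) with a proper continuous map \(r_p\colon M_p\to X\) and a local homeomorphism \(s_p\colon M_p\to X\), where \(M_1=X\) and \(r_1=s_1=\mathrm{id}_X\); and for all \(p,q\in P\) a homeomorphism \(\sigma_{p,q}=(r_{p,q},s_{p,q})\colon M_{pq}\to M_p\times_{s_p,X,r_q}M_q\) with \(r_p r_{p,q}=r_{pq}\) and \(s_q s_{p,q}=s_{pq}\), such that \(\sigma_{p,1},\sigma_{1,q}\) are the canonical homeomorphisms and the two ways of decomposing \(M_{pqt}\) into \(M_p\times_X M_q\times_X M_t\) agree. Let \(H^0=\varprojlim (M_p,r_{p,q})\)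 be the space of all \((m_p)_{p\in P}\in\prod_p M_p\) with \(r_{p,q}(m_{pq})=m_p\) for all \(p,q\), with the subspace topology, and let \(\tilde s_t\colon H^0\to H^0\), \((m_p)_p\mapsto (s_{t,p}(m_{tp}))_p\), for \(t\in P\). Let \(H\) be the groupoid with object space \(H^0\) and arrow set \[H^1=\{(x,g,y)\in H^0\times G\times H^0 \mid \exists\, p_1,p_2\in P:\ g=p_1p_2^{-1},\ \tilde s_{p_1}(x)=\tilde s_{p_2}(y)\},\] with range \(x\), source \(y\) and \((x,g,y)(y,h,z)=(x,gh,z)\), where \(H^1\) carries the quotient topology from the disjoint union over \((p_1,p_2)\in P\times P\) of the spaces \(H^1_{p_1,p_2}=\{(x,y)\in H^0\times H^0\mid\tilde s_{p_1}(x)=\tilde s_{p_2}(y)\}\), each mapped to \(H^1\) by \((x,y)\mapsto(x,p_1p_2^{-1},y)\). The groupoid \(H\) is called locally contracting if for every non-empty open \(U\subseteq H^0\) there are an open subset \(V\subseteq U\) and a bisection \(B\) (an open subset of \(H^1\) on which range \(r\) and source \(s\) are homeomorphisms onto open subsets of \(H^0\)) with \(\overline V\subseteq s(B)\) and \(r(B\overline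 V)\subsetneq V\), where \(r(B\overline V)=\{r(b)\mid b\in B,\ s(b)\in\overline V\}\). Let \(X'=\bigcap_{p\in P} r_p(M_p)\) and \(M'_p=s_p^{-1}(X')\), with the subspace topologies. The action is called locally contracting if for every non-empty, relatively compact, open subset \(S\subseteq X'\) there are \(n\in\mathbb N\), elements \(p_i,q_i,a_i,b_i\in P\) and subsets \(W_i\subseteq M'_{p_i}\times_{s_{p_i},X',s_{q_i}}M'_{q_i}\) for \(1\le i\le n\) such that (LC1) \(p_1a_1=\dots=p_na_n=q_1b_1=\dots=q_nb_n\); (LC2) the coordinate projections \(\mathrm{pr}_1\colon W_i\to M'_{p_i}\) and \(\mathrm{pr}_2\colon W_i\to M'_{q_i}\) are injective and open; (LC3) the subsets \(\mathrm{pr}_1(W_i)M'_{a_i}:=\{\sigma_{p_i,a_i}^{-1}(x_1,x_2)\mid x_1\in \mathrm{pr}_1(W_i),\ x_2\in M'_{a_i},\ s_{p_i}(x_1)=r_{a_i}(x_2)\}\) of \(M'_{p_ia_i}\) are pairwise disjoint, and so are the subsets \(\mathrm{pr}_2(W_i)M'_{b_i}\), defined in the same way; (LC4) \(\overline{\bigsqcup_i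 \mathrm{pr}_1(W_i)M'_{a_i}}\subsetneq\bigsqcup_i \mathrm{pr}_2(W_i)M'_{b_i}\), with the closure taken in \(M'_{p_1a_1}\); (LC5) \(r_{q_i}(\mathrm{pr}_2(W_i))\subseteq S\); (LC6) \(p_iq_i^{-1}\ne p_jq_j^{-1}\) in \(G\) for \(i\ne j\). Theorem. The groupoid \(H\) is locally contracting if and only if the action is locally contracting. -/

import Mathlib

open Set Topology

set_option linter.checkUnivs false

/-! ### Right Ore monoids and their group of fractions -/

/-- A right Ore monoid. -/
class RightOre (P : Type*) [Monoid P] : Prop where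
  ore : ∀ x₁ x₂ : P, ∃ y₁ y₂ : P, x₁ * y₁ = x₂ * y₂
  cancel : ∀ x y₁ y₂ : P, x * y₁ = x * y₂ → ∃ z : P, y₁ * z = y₂ * z

/-- Equivalence of formal right quotients `p q⁻¹`, represented by pairs `(p, q)`. -/
def fracSetoid (P : Type*) [Monoid P] [RightOre P] : Setoid (P × P) where
  r x y := ∃ t₁ t₂ : P, x.1 * t₁ = y.1 * t₂ ∧ x.2 * t₁ = y.2 * t₂
  iseqv := by
    refine ⟨fun x => ⟨1, 1, rfl, rfl⟩, ?_, ?_⟩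
    · rintro x y ⟨t₁, t₂, h, k⟩
      exact ⟨t₂, t₁, h.symm, k.symm⟩
    · rintro x y z ⟨t₁, t₂, h, k⟩ ⟨u₁, u₂, h', k'⟩
      obtain ⟨v, w, e⟩ := RightOre.ore t₂ u₁
      refine ⟨t₁ * v, u₂ * w, ?_, ?_⟩
      · rw [← mul_assoc, h, mul_assoc, e, ← mul_assoc, h', mul_assoc]
      · rw [← mul_assoc, k, mul_assoc, e, ← mul_assoc, k', mul_assoc]

/-- The group completion `G` of a right Ore monoid `P`: formal quotients `p q⁻¹`. -/
def FracGroup (P : Type*) [Monoid P] [RightOre P] : Type _ := Quotient (fracSetoid P)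

namespace FracGroup

variable {P : Type*} [Monoid P] [RightOre P]

/-- The formal quotient `p q⁻¹`. -/
def frac (p q : P) : FracGroup P := Quotient.mk (fracSetoid P) (p, q)

theorem frac_eq_iff {p q p' q' : P} :
    frac p q = frac p' q' ↔ ∃ t₁ t₂ : P, p * t₁ = p' * t₂ ∧ q * t₁ = q' * t₂ :=
  Quotient.eq (r := fracSetoid P)

theorem frac_mul_right (p q t : P) : frac (p * t) (q * t) = frac p q :=
  frac_eq_iff.2 ⟨1, t, by simp, by simp⟩

theorem exists_frac (x : FracGroup P) : ∃ p q : P, x = frac p q := by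
  induction x using Quotient.inductionOn with
  | h a => exact ⟨a.1, a.2, rfl⟩

/-- The product of representatives: `[p₁ t₁, q₂ t₂]` for any `t₁, t₂` with `q₁ t₁ = p₂ t₂`. -/
noncomputable def mulAux (x y : P × P) : FracGroup P :=
  frac (x.1 * (RightOre.ore x.2 y.1).choose) (y.2 * (RightOre.ore x.2 y.1).choose_spec.choose)

theorem mulAux_eq {x y : P × P} {t₁ t₂ : P} (h : x.2 * t₁ = y.1 * t₂) :
    mulAux x y = frac (x.1 * t₁) (y.2 * t₂) := by
  have h' := (RightOre.ore x.2 y.1).choose_spec.choose_spec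
  unfold mulAux
  set s₁ := (RightOre.ore x.2 y.1).choose
  set s₂ := (RightOre.ore x.2 y.1).choose_spec.choose
  obtain ⟨u, u', e⟩ := RightOre.ore s₁ t₁
  have : y.1 * (s₂ * u) = y.1 * (t₂ * u') := by
    rw [← mul_assoc, ← h', mul_assoc, e, ← mul_assoc, h, mul_assoc]
  obtain ⟨z, hz⟩ := RightOre.cancel _ _ _ this
  refine frac_eq_iff.2 ⟨u * z, u' * z, ?_, ?_⟩
  · calc x.1 * s₁ * (u * z) = x.1 * (s₁ * u) * z := by simp only [mul_assoc]
      _ = x.1 * t₁ * (u' * z) := by rw [e]; simp only [mul_assoc]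
  · calc y.2 * s₂ * (u * z) = y.2 * (s₂ * u * z) := by simp only [mul_assoc]
      _ = y.2 * t₂ * (u' * z) := by rw [hz]; simp only [mul_assoc]

theorem mulAux_right_left (x y : P × P) (c : P) :
    mulAux (x.1 * c, x.2 * c) y = mulAux x y := by
  obtain ⟨t₁, t₂, h⟩ := RightOre.ore (x.2 * c) y.1
  rw [mulAux_eq (x := (x.1 * c, x.2 * c)) (y := y) h,
    mulAux_eq (x := x) (y := y) (t₁ := c * t₁) (t₂ := t₂) (by rw [← mul_assoc, h]), mul_assoc]

theorem mulAux_right_right (x y : P × P) (c : P) :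
    mulAux x (y.1 * c, y.2 * c) = mulAux x y := by
  obtain ⟨t₁, t₂, h⟩ := RightOre.ore x.2 (y.1 * c)
  rw [mulAux_eq (x := x) (y := (y.1 * c, y.2 * c)) h,
    mulAux_eq (x := x) (y := y) (t₁ := t₁) (t₂ := c * t₂) (by rw [h, mul_assoc]), mul_assoc]

noncomputable instance : Mul (FracGroup P) where
  mul x y := Quotient.liftOn₂' (s₁ := fracSetoid P) (s₂ := fracSetoid P) x y mulAux (by
    rintro x y x' y' ⟨t₁, t₂, h, k⟩ ⟨u₁, u₂, h', k'⟩
    rw [← mulAux_right_left x y t₁, ← mulAux_right_right _ y u₁, h, k, h', k',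
      mulAux_right_right _ y', mulAux_right_left x'])

instance : One (FracGroup P) := ⟨frac 1 1⟩

instance : Inv (FracGroup P) where
  inv := Quotient.map' (s₁ := fracSetoid P) (s₂ := fracSetoid P) (fun x => (x.2, x.1))
    (by rintro x y ⟨t₁, t₂, h, k⟩; exact ⟨t₁, t₂, k, h⟩)

theorem frac_mul_frac {p₁ q₁ p₂ q₂ t₁ t₂ : P} (h : q₁ * t₁ = p₂ * t₂) :
    frac p₁ q₁ * frac p₂ q₂ = frac (p₁ * t₁) (q₂ * t₂) := by
  have e : frac p₁ q₁ * frac p₂ q₂ = mulAux (p₁, q₁) (p₂, q₂) :=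
    rfl
  rw [e, mulAux_eq (x := (p₁, q₁)) (y := (p₂, q₂)) h]

theorem inv_frac (p q : P) : (frac p q)⁻¹ = frac q p := rfl

theorem frac_mul_cancel (p q t : P) : frac p q * frac q t = frac p t := by
  rw [frac_mul_frac (t₁ := 1) (t₂ := 1) rfl, mul_one, mul_one]

theorem one_eq_frac (p : P) : (1 : FracGroup P) = frac p p :=
  frac_eq_iff.2 ⟨p, 1, by simp, by simp⟩

noncomputable instance : Group (FracGroup P) :=
  Group.ofLeftAxioms
    (by
      intro x y z
      obtain ⟨p, q, rfl⟩ := exists_frac x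
      obtain ⟨p', q', rfl⟩ := exists_frac y
      obtain ⟨p'', q'', rfl⟩ := exists_frac z
      obtain ⟨c, d, h⟩ := RightOre.ore q p'
      obtain ⟨c', d', h'⟩ := RightOre.ore (q' * d) p''
      rw [← frac_mul_right p q (c * c'), ← frac_mul_right p' q' (d * c'),
        ← frac_mul_right p'' q'' d', ← mul_assoc q, ← mul_assoc q', ← mul_assoc p', h, h']
      simp only [frac_mul_cancel])
    (by
      intro x
      obtain ⟨p, q, rfl⟩ := exists_frac x
      rw [one_eq_frac p, frac_mul_cancel])
    (by
      intro x
      obtain ⟨p, q, rfl⟩ := exists_frac x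
      rw [inv_frac, frac_mul_cancel, ← one_eq_frac])

end FracGroup

/-! ### Groupoids and local contractivity -/

/-- A groupoid whose sets of objects and arrows carry topologies. This is the structure on which the
notions of bisection and local contractivity below depend; continuity of the structure maps and
étaleness are properties that play no role in these definitions. -/
structure SpaceGroupoid.{u, v} where
  Obj : Type u
  Arr : Type v
  [topObj : TopologicalSpace Obj]
  [topArr : TopologicalSpace Arr]
  /-- range -/
  r : Arr → Obj
  /-- source -/
  s : Arr → Obj
  unit : Obj → Arr
  inv : Arr → Arr
  mul : (g h : Arr) → s g = r h → Arr
  r_unit : ∀ x, r (unit x) = x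
  s_unit : ∀ x, s (unit x) = x
  r_inv : ∀ g, r (inv g) = s g
  s_inv : ∀ g, s (inv g) = r g
  r_mul : ∀ g h e, r (mul g h e) = r g
  s_mul : ∀ g h e, s (mul g h e) = s h
  unit_mul : ∀ g, mul (unit (r g)) g (s_unit (r g)) = g
  mul_unit : ∀ g, mul g (unit (s g)) (r_unit (s g)).symm = g
  mul_inv : ∀ g, mul g (inv g) (r_inv g).symm = unit (r g)
  inv_mul : ∀ g, mul (inv g) g (s_inv g) = unit (s g)
  mul_assoc : ∀ g h k (e : s g = r h) (f : s h = r k),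
    mul (mul g h e) k ((s_mul g h e).trans f) = mul g (mul h k f) (e.trans (r_mul h k f).symm)

attribute [instance] SpaceGroupoid.topObj SpaceGroupoid.topArr

namespace SpaceGroupoid

variable (𝒢 : SpaceGroupoid)

/-- A bisection: an open set of arrows on which range and source are homeomorphisms onto open
sets of objects. -/
def IsBisection (B : Set 𝒢.Arr) : Prop :=
  IsOpen B ∧ IsOpenEmbedding (B.domRestrict 𝒢.r) ∧ IsOpenEmbedding (B.domRestrict 𝒢.s)

/-- Local contractivity in the sense of Anantharaman-Delaroche. The set `r (B · closure V)` is
the image under `r` of all arrows in `B` with source in `closure V`. -/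
def LocallyContracting : Prop :=
  ∀ U : Set 𝒢.Obj, IsOpen U → U.Nonempty →
    ∃ (V : Set 𝒢.Obj) (B : Set 𝒢.Arr), IsOpen V ∧ V ⊆ U ∧ 𝒢.IsBisection B ∧
      closure V ⊆ 𝒢.s '' B ∧ 𝒢.r '' {b ∈ B | 𝒢.s b ∈ closure V} ⊂ V

end SpaceGroupoid

/-! ### Actions by proper topological correspondences -/

/-- An action of the monoid `P` on the space `X` by proper topological correspondences
`X ← M p → X`. The space `M 1` is identified with `X` through the homeomorphism `r 1 = s 1`, and
`σ p 1`, `σ 1 q` are the canonical homeomorphisms. The fields `assoc₁`, `assoc₂`, `assoc₃` are the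
components in `M p`, `M q`, `M t` of the associativity square. -/
structure CorrAction (P : Type*) [Monoid P] (X : Type*) [TopologicalSpace X] where
  M : P → Type*
  [top : ∀ p, TopologicalSpace (M p)]
  [t2 : ∀ p, T2Space (M p)]
  [locallyCompact : ∀ p, LocallyCompactSpace (M p)]
  r : ∀ p, M p → X
  s : ∀ p, M p → X
  isProperMap_r : ∀ p, IsProperMap (r p)
  isLocalHomeomorph_s : ∀ p, IsLocalHomeomorph (s p)
  σ : ∀ p q, M (p * q) ≃ₜ {x : M p × M q // s p x.1 = r q x.2}
  r_σ : ∀ p q m, r p (σ p q m).1.1 = r (p * q) m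
  s_σ : ∀ p q m, s q (σ p q m).1.2 = s (p * q) m
  isHomeomorph_r_one : IsHomeomorph (r 1)
  s_one : s 1 = r 1
  σ_one_right : ∀ p (m : M (p * 1)), (σ p 1 m).1.1 = cast (congrArg M (mul_one p)) m
  σ_one_left : ∀ q (m : M (1 * q)), (σ 1 q m).1.2 = cast (congrArg M (one_mul q)) m
  assoc₁ : ∀ p q t (m : M (p * q * t)),
    (σ p q (σ (p * q) t m).1.1).1.1 = (σ p (q * t) (cast (congrArg M (mul_assoc p q t)) m)).1.1
  assoc₂ : ∀ p q t (m : M (p * q * t)),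
    (σ p q (σ (p * q) t m).1.1).1.2 =
      (σ q t (σ p (q * t) (cast (congrArg M (mul_assoc p q t)) m)).1.2).1.1
  assoc₃ : ∀ p q t (m : M (p * q * t)),
    (σ (p * q) t m).1.2 =
      (σ q t (σ p (q * t) (cast (congrArg M (mul_assoc p q t)) m)).1.2).1.2

attribute [instance] CorrAction.top CorrAction.t2 CorrAction.locallyCompact

namespace CorrAction

variable {P : Type*} [Monoid P] {X : Type*} [TopologicalSpace X] (A : CorrAction P X)

/-- The map `r_{p,q} : M_{pq} → M_p`. -/
def rr (p q : P) (m : A.M (p * q)) : A.M p := (A.σ p q m).1.1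

/-- The map `s_{p,q} : M_{pq} → M_q`. -/
def ss (p q : P) (m : A.M (p * q)) : A.M q := (A.σ p q m).1.2

/-- The object space `H⁰`: the projective limit of the `M p` along the maps `r_{p,q}`, with the
subspace topology from the product. -/
def History : Type _ := {m : ∀ p, A.M p // ∀ p q, A.rr p q (m (p * q)) = m p}

instance : TopologicalSpace A.History :=
  inferInstanceAs (TopologicalSpace {m : ∀ p, A.M p // ∀ p q, A.rr p q (m (p * q)) = m p})

theorem cast_history (m : ∀ p, A.M p) {p q : P} (h : p = q) :
    cast (congrArg A.M h) (m p) = m q := by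
  subst h; rfl

/-- The map `s̃_t : H⁰ → H⁰`, `(m_p)_p ↦ (s_{t,p}(m_{tp}))_p`. -/
def shift (t : P) (m : A.History) : A.History :=
  ⟨fun p => A.ss t p (m.1 (t * p)), fun p q => by
    have h := A.assoc₂ t p q (m.1 (t * p * q))
    rw [A.cast_history m.1 (mul_assoc t p q)] at h
    have h' := m.2 (t * p) q
    unfold rr at h'
    rw [h'] at h
    exact h.symm⟩

theorem shift_mul (t u : P) (m : A.History) : A.shift (t * u) m = A.shift u (A.shift t m) := by
  refine Subtype.ext (funext fun p => ?_)
  have h := A.assoc₃ t u p (m.1 (t * u * p))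
  rw [A.cast_history m.1 (mul_assoc t u p)] at h
  exact h

variable [RightOre P]

open FracGroup

/-- The set `H¹` of arrows `(x, g, y)` of the transformation groupoid. -/
structure Arrow where
  x : A.History
  g : FracGroup P
  y : A.History
  prop : ∃ p₁ p₂ : P, g = frac p₁ p₂ ∧ A.shift p₁ x = A.shift p₂ y

theorem Arrow.ext' {a b : A.Arrow} (hx : a.x = b.x) (hg : a.g = b.g) (hy : a.y = b.y) :
    a = b := by
  cases a; cases b; simp_all

/-- The canonical map from the disjoint union of the fibre products
`H¹_{p₁,p₂} = {(x, y) | s̃_{p₁}(x) = s̃_{p₂}(y)}` to `H¹`. -/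
def toArrow (a : Σ p : P × P, {z : A.History × A.History // A.shift p.1 z.1 = A.shift p.2 z.2}) :
    A.Arrow :=
  ⟨a.2.1.1, frac a.1.1 a.1.2, a.2.1.2, a.1.1, a.1.2, rfl, a.2.2⟩

/-- The quotient topology from the disjoint union of the `H¹_{p₁,p₂}`. -/
instance : TopologicalSpace A.Arrow :=
  TopologicalSpace.coinduced A.toArrow inferInstance

/-- The transformation groupoid `H`. -/
noncomputable def transformationGroupoid : SpaceGroupoid where
  Obj := A.History
  Arr := A.Arrow
  r a := a.x
  s a := a.y
  unit x := ⟨x, 1, x, 1, 1, rfl, rfl⟩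
  inv a := ⟨a.y, a.g⁻¹, a.x, by
    obtain ⟨p₁, p₂, h, k⟩ := a.prop
    exact ⟨p₂, p₁, by rw [h, inv_frac], k.symm⟩⟩
  mul a b e := ⟨a.x, a.g * b.g, b.y, by
    obtain ⟨p₁, p₂, h, k⟩ := a.prop
    obtain ⟨p₃, p₄, h', k'⟩ := b.prop
    obtain ⟨t, u, f⟩ := RightOre.ore p₂ p₃
    refine ⟨p₁ * t, p₄ * u, by rw [h, h', frac_mul_frac f], ?_⟩
    rw [shift_mul, k, ← shift_mul, f, e, shift_mul, k', ← shift_mul]⟩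
  r_unit _ := rfl
  s_unit _ := rfl
  r_inv _ := rfl
  s_inv _ := rfl
  r_mul _ _ _ := rfl
  s_mul _ _ _ := rfl
  unit_mul a := Arrow.ext' A rfl (one_mul _) rfl
  mul_unit a := Arrow.ext' A rfl (mul_one _) rfl
  mul_inv a := Arrow.ext' A rfl (mul_inv_cancel _) rfl
  inv_mul a := Arrow.ext' A rfl (inv_mul_cancel _) rfl
  mul_assoc a b c _ _ := Arrow.ext' A rfl (_root_.mul_assoc _ _ _) rfl

end CorrAction

namespace CorrAction

variable {P : Type*} [Monoid P] {X : Type*} [TopologicalSpace X] (A : CorrAction P X)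

/-- The set `X'` of possible situations. -/
def possible : Set X := {x | ∀ p, x ∈ Set.range (A.r p)}

/-- The space `M'_p = s_p⁻¹(X')`, with the subspace topology. -/
abbrev MPos (p : P) : Type _ := {m : A.M p // A.s p m ∈ A.possible}

/-- The subset `Y M'_a = {σ_{p,a}⁻¹(x₁, x₂) | x₁ ∈ Y, x₂ ∈ M'_a, s_p(x₁) = r_a(x₂)}` of
`M'_{pa} = M'_e` for `Y ⊆ M'_p` and `p a = e`. -/
def extend {p a e : P} (h : p * a = e) (Y : Set (A.MPos p)) : Set (A.MPos e) :=
  {m | ∃ x₁ ∈ Y, ∃ (x₂ : A.MPos a) (k : A.s p x₁.1 = A.r a x₂.1),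
    m.1 = cast (congrArg A.M h) ((A.σ p a).symm ⟨(x₁.1, x₂.1), k⟩)}

/-- The action is locally contracting. The common value of all `p i * a i` and `q i * b i` is
called `e`. -/
def LocallyContracting [RightOre P] : Prop :=
  ∀ S : Set A.possible, IsOpen S → IsCompact (closure S) → S.Nonempty →
    ∃ (n : ℕ) (p q a b : Fin n → P) (W : ∀ i, Set (A.MPos (p i) × A.MPos (q i)))
      (e : P) (hp : ∀ i, p i * a i = e) (hq : ∀ i, q i * b i = e),
      (∀ i, ∀ w ∈ W i, A.s (p i) w.1.1 = A.s (q i) w.2.1) ∧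
      (∀ i, Function.Injective (fun w : W i => w.1.1) ∧ IsOpenMap (fun w : W i => w.1.1) ∧
        Function.Injective (fun w : W i => w.1.2) ∧ IsOpenMap (fun w : W i => w.1.2)) ∧
      (∀ i j, i ≠ j → Disjoint (A.extend (hp i) (Prod.fst '' W i))
        (A.extend (hp j) (Prod.fst '' W j))) ∧
      (∀ i j, i ≠ j → Disjoint (A.extend (hq i) (Prod.snd '' W i))
        (A.extend (hq j) (Prod.snd '' W j))) ∧
      closure (⋃ i, A.extend (hp i) (Prod.fst '' W i)) ⊂
        (⋃ i, A.extend (hq i) (Prod.snd '' W i)) ∧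
      (∀ i, ∀ w ∈ W i, A.r (q i) w.2.1 ∈ Subtype.val '' S) ∧
      (∀ i j, i ≠ j → FracGroup.frac (p i) (q i) ≠ FracGroup.frac (p j) (q j))

end CorrAction

/-! ### Finite families in a right Ore monoid -/

namespace RightOre

variable {P : Type*} [Monoid P] [RightOre P]

/-! Both notions of contraction express one condition, on `H⁰` and at a finite level. The dictionary
rests on three facts. The projections `H⁰ → M'_p` are surjective, by compactness (`exists_base_eq`,
`exists_pos_eq`). The Ore condition directs the levels, so one coordinate suffices to describe
neighbourhoods (`mem_nhds_history_iff`). Finally `x ↦ (x_p, s̃_p x)` identifies `H⁰` with `M_p ×_X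
H⁰` (`isHomeomorph_split`), so `s̃_p` is open and locally injective like `s_p`. Hence open subsets
of `M_p × M_q` define open sets of arrows, and these exhaust any open set of arrows locally
(`isOpen_arrows`, `exists_mem_arrows_core`); their ranges and sources are cylinders over the
projections of subsets of `M'_p ×_{X'} M'_q`.

From groupoid to action: put a cylinder over an open `N` between `r(B V̄)` and `V`, cover a slightly
larger compact cylinder by finitely many arrow sets in `B`, one for each group element, and cut
their sources down to `N`. The sources then fill the cylinder over `N`, and the ranges stay inside
the image of a compact set.

From action to groupoid: choose a cylinder in `U` over an open `N ⊆ M_t` on which `s_t` is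
injective, and apply the hypothesis to the part of `s_t(N)` in `X'`. The sets `W_i` give a
contracting bisection over `s_t(N)`, which is lifted into `U` by conjugation with the arrows `(x, t,
s̃_t x)`. -/

theorem exists_common_multiple (F : Finset P) : ∃ e : P, ∀ p ∈ F, ∃ c, p * c = e := by
  classical
  induction F using Finset.induction_on with
  | empty => exact ⟨1, by simp⟩
  | insert p F _ ih =>
    obtain ⟨e, he⟩ := ih
    obtain ⟨u, v, h⟩ := ore p e
    refine ⟨e * v, fun p' hp' => ?_⟩
    rcases Finset.mem_insert.1 hp' with rfl | hp'
    · exact ⟨u, h⟩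
    · obtain ⟨c, rfl⟩ := he p' hp'
      exact ⟨c * v, (mul_assoc _ _ _).symm⟩

theorem exists_equalizer (F : Finset (P × P × P)) (hF : ∀ x ∈ F, x.1 * x.2.1 = x.1 * x.2.2) :
    ∃ z : P, ∀ x ∈ F, x.2.1 * z = x.2.2 * z := by
  classical
  induction F using Finset.induction_on with
  | empty => exact ⟨1, by simp⟩
  | insert x F _ ih =>
    obtain ⟨z, hz⟩ := ih fun y hy => hF y (Finset.mem_insert_of_mem hy)
    obtain ⟨w, hw⟩ := cancel x.1 (x.2.1 * z) (x.2.2 * z) (by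
      rw [← mul_assoc, hF x (Finset.mem_insert_self _ _), mul_assoc])
    refine ⟨z * w, fun y hy => ?_⟩
    rcases Finset.mem_insert.1 hy with rfl | hy
    · simpa only [mul_assoc] using hw
    · rw [← mul_assoc, hz y hy, mul_assoc]

/-- Finitely many multiplications in `P` are dominated by a single compatible cone. -/
theorem exists_cone (F : Finset (P × P)) : ∃ (e : P) (f : P → P),
    ∀ x ∈ F, x.1 * f x.1 = e ∧ x.1 * x.2 * f (x.1 * x.2) = e ∧ f x.1 = x.2 * f (x.1 * x.2) := by
  classical
  obtain ⟨e, he⟩ := exists_common_multiple (F.image (fun x => x.1) ∪ F.image fun x => x.1 * x.2)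
  choose! f hf using he
  have h₁ : ∀ x ∈ F, x.1 * f x.1 = e := fun x hx =>
    hf _ (Finset.mem_union_left _ (Finset.mem_image_of_mem _ hx))
  have h₂ : ∀ x ∈ F, x.1 * x.2 * f (x.1 * x.2) = e := fun x hx =>
    hf _ (Finset.mem_union_right _ (Finset.mem_image_of_mem (fun x : P × P => x.1 * x.2) hx))
  obtain ⟨z, hz⟩ := exists_equalizer
    (F.image fun x => (x.1, f x.1, x.2 * f (x.1 * x.2))) (by
      intro y hy
      obtain ⟨x, hx, rfl⟩ := Finset.mem_image.1 hy
      simp only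
      rw [h₁ x hx, ← mul_assoc, h₂ x hx])
  refine ⟨e * z, fun p => f p * z, fun x hx => ⟨?_, ?_, ?_⟩⟩
  · rw [← mul_assoc, h₁ x hx]
  · rw [← mul_assoc, h₂ x hx]
  · simpa only [mul_assoc] using hz _ (Finset.mem_image_of_mem _ hx)

end RightOre

/-! ### The space of histories and its projections -/

namespace CorrAction

variable {P : Type*} [Monoid P] {X : Type*} [TopologicalSpace X] (A : CorrAction P X)

theorem continuous_rr (p q : P) : Continuous (A.rr p q) :=
  continuous_fst.comp (continuous_subtype_val.comp (A.σ p q).continuous)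

theorem continuous_ss (p q : P) : Continuous (A.ss p q) :=
  continuous_snd.comp (continuous_subtype_val.comp (A.σ p q).continuous)

theorem continuous_s (p : P) : Continuous (A.s p) := (A.isLocalHomeomorph_s p).continuous

theorem continuous_r (p : P) : Continuous (A.r p) := (A.isProperMap_r p).continuous

/-- The map `r_{p,c} : M_e → M_p` for `e = p c`. -/
def res {p e : P} (c : P) (h : p * c = e) (m : A.M e) : A.M p :=
  A.rr p c (cast (congrArg A.M h.symm) m)

theorem continuous_res {p e : P} (c : P) (h : p * c = e) : Continuous (A.res c h) := by
  subst h
  exact A.continuous_rr p c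

theorem r_res {p e : P} (c : P) (h : p * c = e) (m : A.M e) : A.r p (A.res c h m) = A.r e m := by
  subst h
  exact A.r_σ p c m

theorem res_res {p q e : P} (c d : P) (h : p * c = q) (k : q * d = e) (m : A.M e) :
    A.res c h (A.res d k m) =
      A.res (c * d) (by rw [← mul_assoc, h, k]) m := by
  subst h k
  exact A.assoc₁ p c d m

theorem res_congr {p e : P} {c d : P} (hcd : c = d) (h : p * c = e) (m : A.M e) :
    A.res c h m = A.res d (hcd ▸ h) m := by
  subst hcd
  rfl

theorem res_history (x : A.History) {p e : P} (c : P) (h : p * c = e) :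
    A.res c h (x.1 e) = x.1 p := by
  subst h
  exact x.2 p c

theorem isClosed_possible [T2Space X] : IsClosed A.possible := by
  have : A.possible = ⋂ p, range (A.r p) := by ext; simp [possible]
  rw [this]
  exact isClosed_iInter fun p => (A.isProperMap_r p).isClosedMap.isClosed_range

/-- The projection `H⁰ → X`. -/
def base (x : A.History) : X := A.r 1 (x.1 1)

theorem r_history (x : A.History) (p : P) : A.r p (x.1 p) = A.base x := by
  rw [base, ← A.res_history x p (one_mul p), r_res]

theorem base_shift (t : P) (x : A.History) : A.base (A.shift t x) = A.s t (x.1 t) := by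
  have h := (A.σ t 1 (x.1 (t * 1))).2
  have h' := x.2 t 1
  rw [← h']
  exact h.symm

theorem base_mem_possible (x : A.History) : A.base x ∈ A.possible :=
  fun p => ⟨x.1 p, A.r_history x p⟩

theorem s_history_mem (p : P) (x : A.History) : A.s p (x.1 p) ∈ A.possible :=
  A.base_shift p x ▸ A.base_mem_possible _

/-- The projection `H⁰ → M'_p`. -/
def pos (p : P) (x : A.History) : A.MPos p := ⟨x.1 p, A.s_history_mem p x⟩

theorem isEmbedding_history : IsEmbedding (fun x : A.History => x.1) := IsEmbedding.subtypeVal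

theorem continuous_history (p : P) : Continuous fun x : A.History => x.1 p :=
  (continuous_apply p).comp A.isEmbedding_history.continuous

theorem continuous_pos (p : P) : Continuous (A.pos p) :=
  (A.continuous_history p).subtype_mk _

theorem continuous_base : Continuous A.base := (A.continuous_r 1).comp (A.continuous_history 1)

theorem continuous_shift (t : P) : Continuous (A.shift t) := by
  refine A.isEmbedding_history.isInducing.continuous_iff.2 (continuous_pi fun p => ?_)
  exact (A.continuous_ss t p).comp (A.continuous_history (t * p))

instance : T2Space A.History := A.isEmbedding_history.t2Space

theorem isClosed_range_history : IsClosed (range fun x : A.History => x.1) := by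
  have : (range fun x : A.History => x.1) = ⋂ p, ⋂ q, {m | A.rr p q (m (p * q)) = m p} := by
    ext m
    simp only [mem_range, mem_iInter, mem_ofPred_eq]
    exact ⟨by rintro ⟨x, rfl⟩; exact x.2, fun h => ⟨⟨m, h⟩, rfl⟩⟩
  rw [this]
  exact isClosed_iInter fun p => isClosed_iInter fun q =>
    isClosed_eq ((A.continuous_rr p q).comp (continuous_apply _)) (continuous_apply _)

/-- Every coordinate of a history lies over the same base point, so this set is a closed part of the
product of the compact sets `r_p⁻¹(K)`; Tychonoff's theorem applies. -/
theorem isCompact_base_preimage {K : Set X} (hK : IsCompact K) : IsCompact (A.base ⁻¹' K) := by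
  have h : A.base ⁻¹' K = (fun x : A.History => x.1) ⁻¹' (univ.pi fun p => A.r p ⁻¹' K) := by
    ext x
    simp [mem_pi, r_history]
  rw [h]
  have hc : IsClosedEmbedding (fun x : A.History => x.1) :=
    ⟨A.isEmbedding_history, A.isClosed_range_history⟩
  exact hc.isCompact_preimage (isCompact_univ_pi fun p => (A.isProperMap_r p).isCompact_preimage hK)

instance [LocallyCompactSpace X] : LocallyCompactSpace A.History := by
  have : WeaklyLocallyCompactSpace A.History := ⟨fun x => by
    obtain ⟨K, hK, hx⟩ := exists_compact_mem_nhds (A.base x)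
    exact ⟨_, A.isCompact_base_preimage hK, A.continuous_base.continuousAt hx⟩⟩
  infer_instance

theorem nhds_history (x : A.History) : 𝓝 x = ⨅ p, (𝓝 (x.1 p)).comap fun y : A.History => y.1 p := by
  rw [A.isEmbedding_history.isInducing.nhds_eq_comap, nhds_pi, Filter.pi, Filter.comap_iInf]
  simp only [Filter.comap_comap]
  rfl

theorem comap_nhds_anti (x : A.History) {p e : P} (c : P) (h : p * c = e) :
    ((𝓝 (x.1 e)).comap fun y : A.History => y.1 e) ≤
      (𝓝 (x.1 p)).comap fun y : A.History => y.1 p := by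
  have : (fun y : A.History => y.1 p) = A.res c h ∘ fun y : A.History => y.1 e :=
    funext fun y => (A.res_history y c h).symm
  rw [this, ← Filter.comap_comap]
  refine Filter.comap_mono (Filter.map_le_iff_le_comap.1 ?_)
  rw [← A.res_history x c h]
  exact (A.continuous_res c h).continuousAt

variable [RightOre P]

/-- The fibres `r_p⁻¹(x)` are compact and the compatibility conditions are closed, so it suffices to
satisfy finitely many of them. Restricting a single point of `M_e` over `x` along a cone does so. -/
theorem exists_base_eq {x : X} (hx : x ∈ A.possible) : ∃ z : A.History, A.base z = x := by
  classical
  choose m hm using hx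
  let C : P × P → Set (∀ p, A.M p) := fun a => {y | A.rr a.1 a.2 (y (a.1 * a.2)) = y a.1}
  have hC : ∀ a, IsClosed (C a) := fun a =>
    isClosed_eq ((A.continuous_rr _ _).comp (continuous_apply _)) (continuous_apply _)
  obtain ⟨y, hy, hyC⟩ := (isCompact_univ_pi fun p =>
    (A.isProperMap_r p).isCompact_preimage (isCompact_singleton (x := x))).inter_iInter_nonempty
      C hC (by
    intro F
    obtain ⟨e, f, hf⟩ := RightOre.exists_cone F
    -- Off the cone no chosen condition is active, and any point of the fibre will do.
    refine ⟨fun p => if h : p * f p = e then A.res (f p) h (m e) else m p, ?_, ?_⟩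
    · intro p _
      simp only [mem_preimage, mem_singleton_iff]
      split_ifs with h
      · rw [r_res, hm]
      · exact hm p
    · simp only [mem_iInter]
      intro a ha
      obtain ⟨h₁, h₂, h₃⟩ := hf a ha
      simp only [C, mem_ofPred_eq, dif_pos h₁, dif_pos h₂]
      rw [A.res_congr h₃]
      exact A.res_res a.2 _ rfl h₂ (m e))
  simp only [mem_iInter] at hyC
  exact ⟨⟨y, fun p q => hyC (p, q)⟩, hy 1 trivial⟩

/-- Through `σ`, the coordinate at `p * c` is determined by `x_p` and the `c`-coordinate of `s̃_p
x`; by the Ore condition the levels `p * c` are cofinal. -/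
theorem history_eq_of {p : P} {x y : A.History} (h : x.1 p = y.1 p)
    (k : A.shift p x = A.shift p y) : x = y := by
  refine Subtype.ext (funext fun q => ?_)
  obtain ⟨c, d, e⟩ := RightOre.ore p q
  rw [← A.res_history x d e.symm, ← A.res_history y d e.symm]
  congr 1
  refine (A.σ p c).injective (Subtype.ext (Prod.ext ?_ ?_))
  · exact (x.2 p c).trans (h.trans (y.2 p c).symm)
  · exact congrFun (congrArg Subtype.val k) c

theorem mem_nhds_history_iff {x : A.History} {U : Set A.History} :
    U ∈ 𝓝 x ↔ ∃ p, ∃ N ∈ 𝓝 (x.1 p), (fun y : A.History => y.1 p) ⁻¹' N ⊆ U := by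
  rw [nhds_history, Filter.mem_iInf_of_directed]
  · simp only [Filter.mem_comap]
  · intro p q
    obtain ⟨c, d, h⟩ := RightOre.ore p q
    exact ⟨p * c, A.comap_nhds_anti x c rfl, A.comap_nhds_anti x d h.symm⟩

theorem nhds_history_cofinal (x : A.History) (p : P) :
    𝓝 x = ⨅ c, (𝓝 (x.1 (p * c))).comap fun y : A.History => y.1 (p * c) := by
  rw [nhds_history]
  refine le_antisymm (le_iInf fun c => iInf_le _ _) (le_iInf fun q => ?_)
  obtain ⟨c, d, h⟩ := RightOre.ore p q
  exact (iInf_le _ c).trans (A.comap_nhds_anti x d h.symm)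

end CorrAction

/-! ### Base change of open maps, and local injectivity -/

theorem isOpen_image_fst_of_eq {Y Z W : Type*} [TopologicalSpace Y] [TopologicalSpace Z]
    [TopologicalSpace W] {f : Y → Z} {g : W → Z} (hf : Continuous f) (hg : IsOpenMap g)
    {O : Set (Y × W)} (hO : IsOpen O) : IsOpen (Prod.fst '' {z ∈ O | f z.1 = g z.2}) := by
  rw [isOpen_iff_mem_nhds]
  rintro _ ⟨⟨y, w⟩, ⟨h, e⟩, rfl⟩
  obtain ⟨N₁, N₂, h₁, h₂, hy, hw, hN⟩ := isOpen_prod_iff.1 hO y w h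
  -- Openness of `g` ensures that points near `y` still have a partner in `N₂`.
  have : f ⁻¹' (g '' N₂) ∈ 𝓝 y := hf.continuousAt ((hg _ h₂).mem_nhds ⟨w, hw, e.symm⟩)
  filter_upwards [this, h₁.mem_nhds hy] with y' ⟨w', hw', e'⟩ hy'
  exact ⟨(y', w'), ⟨hN ⟨hy', hw'⟩, e'.symm⟩, rfl⟩

theorem isOpen_image_snd_of_eq {Y Z W : Type*} [TopologicalSpace Y] [TopologicalSpace Z]
    [TopologicalSpace W] {f : Y → Z} {g : W → Z} (hf : IsOpenMap f) (hg : Continuous g)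
    {O : Set (Y × W)} (hO : IsOpen O) : IsOpen (Prod.snd '' {z ∈ O | f z.1 = g z.2}) := by
  have h := isOpen_image_fst_of_eq hg hf (hO.preimage continuous_swap)
  convert h using 1
  ext w
  constructor
  · rintro ⟨⟨y, w⟩, ⟨h, e⟩, rfl⟩
    exact ⟨(w, y), ⟨h, e.symm⟩, rfl⟩
  · rintro ⟨⟨w, y⟩, ⟨h, e⟩, rfl⟩
    exact ⟨(y, w), ⟨h, e.symm⟩, rfl⟩

theorem IsLocalHomeomorph.exists_injOn {Y Z : Type*} [TopologicalSpace Y] [TopologicalSpace Z]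
    {f : Y → Z} (hf : IsLocalHomeomorph f) (y : Y) : ∃ N, IsOpen N ∧ y ∈ N ∧ InjOn f N := by
  obtain ⟨φ, hy, rfl⟩ := hf y
  exact ⟨φ.source, φ.open_source, hy, φ.injOn⟩

/-! ### Gluing histories; the shift maps are open and locally injective -/

namespace CorrAction

variable {P : Type*} [Monoid P] {X : Type*} [TopologicalSpace X] (A : CorrAction P X)

section Extension

variable {p : P} {m : A.M p} {z : A.History} (h : A.s p m = A.base z)

/-- The component in `M_{pc}` of the history composed of `m ∈ M_p` and `z ∈ H⁰`. -/
def glueAux (c : P) : A.M (p * c) :=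
  (A.σ p c).symm ⟨(m, z.1 c), h.trans (A.r_history z c).symm⟩

theorem rr_glueAux (c : P) : A.rr p c (A.glueAux h c) = m := by
  simp [rr, glueAux]

theorem ss_glueAux (c : P) : A.ss p c (A.glueAux h c) = z.1 c := by
  simp [ss, glueAux]

theorem res_glueAux (c d : P) :
    A.res d (mul_assoc p c d) (A.glueAux h (c * d)) = A.glueAux h c := by
  have key : ∀ m' : A.M (p * c * d),
      cast (congrArg A.M (mul_assoc p c d)) m' = A.glueAux h (c * d) →
      A.rr (p * c) d m' = A.glueAux h c := by
    intro m' hm'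
    have h₁ := A.assoc₁ p c d m'
    have h₂ := A.assoc₂ p c d m'
    rw [hm'] at h₁ h₂
    refine (A.σ p c).injective (Subtype.ext (Prod.ext ?_ ?_))
    · exact h₁.trans ((A.rr_glueAux h _).trans (A.rr_glueAux h _).symm)
    · have h₃ : (A.σ p (c * d) (A.glueAux h (c * d))).1.2 = z.1 (c * d) := A.ss_glueAux h _
      rw [h₃] at h₂
      exact h₂.trans ((z.2 c d).trans (A.ss_glueAux h c).symm)
  exact key _ (by simp)

theorem res_glueAux' {q c d w c' : P} (e : q * d = p * c) (hc : c * w = c') :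
    A.res (d * w) (by rw [← mul_assoc, e, mul_assoc, hc]) (A.glueAux h c') =
      A.res d e (A.glueAux h c) := by
  subst hc
  rw [← A.res_glueAux h c w, A.res_res]

variable [RightOre P]

/-- The coordinate at `q` does not depend on the level beyond `q` from which it is read. A common
multiple of `c` and `c'` yields two factors that agree only after left multiplication by `q`; the
second Ore condition removes this defect. -/
theorem res_glueAux_eq {q c d c' d' : P} (e : q * d = p * c) (e' : q * d' = p * c') :
    A.res d e (A.glueAux h c) = A.res d' e' (A.glueAux h c') := by
  obtain ⟨v, w, hv⟩ := RightOre.ore c c'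
  obtain ⟨z', hz⟩ := RightOre.cancel q (d * v) (d' * w) (by
    rw [← mul_assoc, ← mul_assoc, e, e', mul_assoc, mul_assoc, hv])
  have hc : c' * (w * z') = c * (v * z') := by rw [← mul_assoc, ← mul_assoc, hv]
  rw [← A.res_glueAux' h e (w := v * z') rfl, ← A.res_glueAux' h e' hc]
  exact A.res_congr (by rw [← mul_assoc, ← mul_assoc, hz]) _ _

theorem exists_glue (h : A.s p m = A.base z) : ∃ x : A.History, x.1 p = m ∧ A.shift p x = z := by
  -- For each `q`, pick a level `p * c q` beyond `q` and restrict the glued element from there.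
  choose d c e using fun q => RightOre.ore q p
  let x : A.History := ⟨fun q => A.res (d q) (e q) (A.glueAux h (c q)), fun q t => by
    refine (A.res_res t (d (q * t)) rfl (e (q * t)) _).trans ?_
    exact A.res_glueAux_eq h _ _⟩
  have hx : ∀ b, x.1 (p * b) = A.glueAux h b := fun b => by
    refine (A.res_glueAux_eq h (e (p * b)) (show p * b * 1 = p * (b * 1) from mul_assoc _ _ _)).trans ?_
    exact A.res_glueAux h b 1
  refine ⟨x, ?_, Subtype.ext (funext fun b => ?_)⟩
  · rw [← x.2 p 1, hx, rr_glueAux]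
  · exact (congrArg (A.ss p b) (hx b)).trans (A.ss_glueAux h b)

end Extension

/-- A history splits into its behaviour up to time `p` and the shifted history. -/
def split (p : P) (x : A.History) : {z : A.M p × A.History // A.s p z.1 = A.base z.2} :=
  ⟨(x.1 p, A.shift p x), (A.base_shift p x).symm⟩

theorem continuous_split (p : P) : Continuous (A.split p) :=
  ((A.continuous_history p).prodMk (A.continuous_shift p)).subtype_mk _

variable [RightOre P]

theorem exists_pos_eq {p : P} (m : A.MPos p) : ∃ x, A.pos p x = m := by
  obtain ⟨z, hz⟩ := A.exists_base_eq m.2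
  obtain ⟨x, hx, -⟩ := A.exists_glue hz.symm
  exact ⟨x, Subtype.ext hx⟩

theorem split_bijective (p : P) : Function.Bijective (A.split p) := by
  refine ⟨fun x y h => ?_, fun z => ?_⟩
  · have h' := congrArg Subtype.val h
    exact A.history_eq_of (congrArg Prod.fst h') (congrArg Prod.snd h')
  · obtain ⟨x, h, k⟩ := A.exists_glue z.2
    exact ⟨x, Subtype.ext (Prod.ext h k)⟩

/-- Continuity of the inverse need only be tested at the cofinal levels `p * c`, where it is given
by the inverse of `σ p c`. -/
theorem isHomeomorph_split (p : P) : IsHomeomorph (A.split p) := by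
  refine (Equiv.ofBijective _ (A.split_bijective p)).isHomeomorph_iff.2
    ⟨A.continuous_split p, ?_⟩
  set ψ := (Equiv.ofBijective _ (A.split_bijective p)).symm with hψ
  rw [continuous_iff_continuousAt]
  intro z
  rw [ContinuousAt, A.nhds_history_cofinal _ p]
  refine Filter.tendsto_iInf.2 fun c => Filter.tendsto_comap_iff.2 ?_
  have hfun : (fun y : A.History => y.1 (p * c)) ∘ ψ = fun z => A.glueAux z.2 c := by
    funext z
    obtain ⟨x, rfl⟩ := (A.split_bijective p).2 z
    have hx : ψ (A.split p x) = x :=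
      (Equiv.ofBijective _ (A.split_bijective p)).symm_apply_apply x
    simp only [Function.comp_apply, hx]
    refine (A.σ p c).injective (Subtype.ext (Prod.ext ?_ ?_))
    · exact (x.2 p c).trans (A.rr_glueAux (A.split p x).2 c).symm
    · exact (A.ss_glueAux (A.split p x).2 c).symm
  have hz : (ψ z).1 (p * c) = A.glueAux z.2 c := congrFun hfun z
  rw [hfun, hz]
  refine Continuous.tendsto (f := fun z : {z : A.M p × A.History // A.s p z.1 = A.base z.2} =>
    A.glueAux z.2 c) ?_ z
  refine (A.σ p c).symm.continuous.comp (Continuous.subtype_mk ?_ _)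
  exact (continuous_fst.comp continuous_subtype_val).prodMk
    ((A.continuous_history c).comp (continuous_snd.comp continuous_subtype_val))

/-- Under `split`, the shift becomes the base change of the open map `s_p` along `base`. -/
theorem isOpenMap_shift (p : P) : IsOpenMap (A.shift p) := by
  intro U hU
  obtain ⟨O, hO, hOU⟩ := isOpen_induced_iff.1 ((A.isHomeomorph_split p).isOpenMap U hU)
  convert isOpen_image_snd_of_eq (A.isLocalHomeomorph_s p).isOpenMap A.continuous_base hO using 1
  ext z
  constructor
  · rintro ⟨x, hx, rfl⟩
    have : A.split p x ∈ Subtype.val ⁻¹' O := hOU ▸ mem_image_of_mem _ hx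
    exact ⟨(A.split p x).1, ⟨this, (A.split p x).2⟩, rfl⟩
  · rintro ⟨y, ⟨hy, e⟩, rfl⟩
    have : (⟨y, e⟩ : {z : A.M p × A.History // A.s p z.1 = A.base z.2}) ∈ A.split p '' U :=
      hOU ▸ hy
    obtain ⟨x, hx, hxy⟩ := this
    exact ⟨x, hx, congrArg (fun z => z.1.2) hxy⟩

theorem eq_of_shift_eq {p : P} {N : Set (A.M p)} (hN : InjOn (A.s p) N) {x y : A.History}
    (hx : x.1 p ∈ N) (hy : y.1 p ∈ N) (h : A.shift p x = A.shift p y) : x = y :=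
  A.history_eq_of (hN hx hy (by rw [← base_shift, ← base_shift, h])) h

end CorrAction

/-! ### Open sets of arrows in finite-level coordinates -/

namespace CorrAction

variable {P : Type*} [Monoid P] {X : Type*} [TopologicalSpace X] (A : CorrAction P X)

/-- Extension to a later level leaves the cylinder in `H⁰` unchanged. Together with `exists_pos_eq`
this moves (LC3) and (LC4) to `H⁰`. -/
theorem mem_extend_iff {p a e : P} (h : p * a = e) {Y : Set (A.MPos p)} (x : A.History) :
    A.pos e x ∈ A.extend h Y ↔ A.pos p x ∈ Y := by
  subst h
  constructor
  · rintro ⟨x₁, hx₁, x₂, k, hx⟩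
    have : x₁ = A.pos p x := by
      refine Subtype.ext ?_
      have h₁ : x.1 (p * a) = (A.σ p a).symm ⟨(x₁.1, x₂.1), k⟩ := hx
      change x₁.1 = x.1 p
      rw [← x.2 p a, h₁, rr, Homeomorph.apply_symm_apply]
    rwa [← this]
  · intro hx
    refine ⟨_, hx, A.pos a (A.shift p x), ?_, ?_⟩
    · exact (A.base_shift p x).symm.trans (A.r_history _ a).symm
    · refine (A.σ p a).injective (Eq.trans (Subtype.ext (Prod.ext ?_ ?_))
        (Homeomorph.apply_symm_apply (A.σ p a) _).symm)
      · exact x.2 p a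
      · rfl

variable [RightOre P]

open FracGroup

theorem eventually_shift_injective (t : P) (z : A.History) :
    ∀ᶠ w : A.History × A.History in 𝓝 (z, z), A.shift t w.1 = A.shift t w.2 → w.1 = w.2 := by
  obtain ⟨N, hN, hz, hinj⟩ := (A.isLocalHomeomorph_s t).exists_injOn (z.1 t)
  have h := (A.continuous_history t).continuousAt (hN.mem_nhds hz)
  rw [nhds_prod_eq]
  filter_upwards [Filter.prod_mem_prod h h] with w hw e
  exact A.eq_of_shift_eq hinj hw.1 hw.2 e

theorem isOpen_arrow_iff {O : Set A.Arrow} :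
    IsOpen O ↔ ∀ p q : P, IsOpen
      {z : {z : A.History × A.History // A.shift p z.1 = A.shift q z.2} |
        A.toArrow ⟨(p, q), z⟩ ∈ O} := by
  rw [isOpen_coinduced, isOpen_sigma_iff]
  exact ⟨fun h p q => h (p, q), fun h a => h a.1 a.2⟩

theorem continuous_arrow_iff {Z : Type*} [TopologicalSpace Z] {f : A.Arrow → Z} :
    Continuous f ↔ ∀ p q : P, Continuous
      fun z : {z : A.History × A.History // A.shift p z.1 = A.shift q z.2} =>
        f (A.toArrow ⟨(p, q), z⟩) := by
  rw [continuous_coinduced_dom, continuous_sigma_iff]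
  exact ⟨fun h p q => h (p, q), fun h a => h a.1 a.2⟩

theorem continuous_toArrow (p q : P) : Continuous
    fun z : {z : A.History × A.History // A.shift p z.1 = A.shift q z.2} =>
      A.toArrow ⟨(p, q), z⟩ :=
  A.continuous_arrow_iff.1 continuous_id p q

theorem continuous_range : Continuous (Arrow.x (A := A)) :=
  A.continuous_arrow_iff.2 fun _ _ => continuous_fst.comp continuous_subtype_val

theorem continuous_source : Continuous (Arrow.y (A := A)) :=
  A.continuous_arrow_iff.2 fun _ _ => continuous_snd.comp continuous_subtype_val

theorem isOpenMap_range : IsOpenMap (Arrow.x (A := A)) := by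
  intro O hO
  have h : Arrow.x '' O = ⋃ p : P, ⋃ q : P, (fun z : {z : A.History × A.History //
      A.shift p z.1 = A.shift q z.2} => z.1.1) '' {z | A.toArrow ⟨(p, q), z⟩ ∈ O} := by
    ext x
    simp only [mem_iUnion]
    constructor
    · rintro ⟨⟨x, g, y, p, q, rfl, k⟩, h, rfl⟩
      exact ⟨p, q, ⟨(x, y), k⟩, h, rfl⟩
    · rintro ⟨p, q, z, h, rfl⟩
      exact ⟨_, h, rfl⟩
  rw [h]
  refine isOpen_iUnion fun p => isOpen_iUnion fun q => ?_
  obtain ⟨O', hO', e⟩ := isOpen_induced_iff.1 (A.isOpen_arrow_iff.1 hO p q)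
  convert isOpen_image_fst_of_eq (A.continuous_shift p) (A.isOpenMap_shift q) hO' using 1
  rw [← e]
  ext x
  constructor
  · rintro ⟨z, hz, rfl⟩
    exact ⟨z.1, ⟨hz, z.2⟩, rfl⟩
  · rintro ⟨z, ⟨hz, k⟩, rfl⟩
    exact ⟨⟨z, k⟩, hz, rfl⟩

theorem isOpenMap_source : IsOpenMap (Arrow.y (A := A)) := by
  intro O hO
  have h : Arrow.y '' O = ⋃ p : P, ⋃ q : P, (fun z : {z : A.History × A.History //
      A.shift p z.1 = A.shift q z.2} => z.1.2) '' {z | A.toArrow ⟨(p, q), z⟩ ∈ O} := by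
    ext x
    simp only [mem_iUnion]
    constructor
    · rintro ⟨⟨x, g, y, p, q, rfl, k⟩, h, rfl⟩
      exact ⟨p, q, ⟨(x, y), k⟩, h, rfl⟩
    · rintro ⟨p, q, z, h, rfl⟩
      exact ⟨_, h, rfl⟩
  rw [h]
  refine isOpen_iUnion fun p => isOpen_iUnion fun q => ?_
  obtain ⟨O', hO', e⟩ := isOpen_induced_iff.1 (A.isOpen_arrow_iff.1 hO p q)
  convert isOpen_image_snd_of_eq (A.isOpenMap_shift p) (A.continuous_shift q) hO' using 1
  rw [← e]
  ext x
  constructor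
  · rintro ⟨z, hz, rfl⟩
    exact ⟨z.1, ⟨hz, z.2⟩, rfl⟩
  · rintro ⟨z, ⟨hz, k⟩, rfl⟩
    exact ⟨⟨z, k⟩, hz, rfl⟩

/-- Range and source are continuous and open on all of `H¹`, so on an open set only injectivity is
at stake. -/
theorem isBisection_iff {B : Set A.Arrow} :
    A.transformationGroupoid.IsBisection B ↔
      IsOpen B ∧ InjOn (Arrow.x (A := A)) B ∧ InjOn (Arrow.y (A := A)) B := by
  constructor
  · rintro ⟨h, hr, hs⟩
    exact ⟨h, injOn_iff_injective.2 hr.injective, injOn_iff_injective.2 hs.injective⟩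
  · rintro ⟨h, hr, hs⟩
    have hB : IsOpen (X := A.Arrow) B := h
    refine ⟨h, ?_, ?_⟩
    · exact .of_continuous_injective_isOpenMap
        (A.continuous_range.comp continuous_subtype_val) (injOn_iff_injective.1 hr)
        (A.isOpenMap_range.comp hB.isOpenMap_subtype_val)
    · exact .of_continuous_injective_isOpenMap
        (A.continuous_source.comp continuous_subtype_val) (injOn_iff_injective.1 hs)
        (A.isOpenMap_source.comp hB.isOpenMap_subtype_val)

/-- The arrows `(x, p q⁻¹, y)` with `s̃_p(x) = s̃_q(y)` and `(x_p, y_q) ∈ O`. -/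
def arrows (p q : P) (O : Set (A.M p × A.M q)) : Set A.Arrow :=
  {a | a.g = frac p q ∧ A.shift p a.x = A.shift q a.y ∧ (a.x.1 p, a.y.1 q) ∈ O}

/-- The arrow `(x, p q⁻¹, y)`. -/
def mkArrow (p q : P) {x y : A.History} (h : A.shift p x = A.shift q y) : A.Arrow :=
  ⟨x, frac p q, y, p, q, rfl, h⟩

/-- For another representative `(p', q')` of the same fraction, `s̃_p x` and `s̃_q y` are a priori
equal only after applying some `s̃_{t'}`. Near a given arrow of the set, local injectivity of
`s̃_{t'}` cancels it. -/
theorem isOpen_arrows (p q : P) {O : Set (A.M p × A.M q)} (hO : IsOpen O) :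
    IsOpen (A.arrows p q O) := by
  refine A.isOpen_arrow_iff.2 fun p' q' => ?_
  rw [isOpen_iff_mem_nhds]
  rintro ⟨⟨x, y⟩, k⟩ ⟨hg, h, hxy⟩
  obtain ⟨t, t', e, e'⟩ := frac_eq_iff.1 hg
  have h₁ : Filter.Tendsto (fun z : {z : A.History × A.History //
      A.shift p' z.1 = A.shift q' z.2} => (A.shift p z.1.1, A.shift q z.1.2))
      (𝓝 ⟨(x, y), k⟩) (𝓝 (A.shift p x, A.shift p x)) := by
    have : Continuous (fun z : {z : A.History × A.History //
      A.shift p' z.1 = A.shift q' z.2} => (A.shift p z.1.1, A.shift q z.1.2)) :=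
      ((A.continuous_shift p).comp (continuous_fst.comp continuous_subtype_val)).prodMk
        ((A.continuous_shift q).comp (continuous_snd.comp continuous_subtype_val))
    have h₂ := this.tendsto ⟨(x, y), k⟩
    have h₃ : A.shift p x = A.shift q y := h
    simpa only [← h₃] using h₂
  have h₂ : Continuous (fun z : {z : A.History × A.History //
      A.shift p' z.1 = A.shift q' z.2} => (z.1.1.1 p, z.1.2.1 q)) :=
    ((A.continuous_history p).comp (continuous_fst.comp continuous_subtype_val)).prodMk
      ((A.continuous_history q).comp (continuous_snd.comp continuous_subtype_val))
  filter_upwards [h₁ (A.eventually_shift_injective t' _),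
    h₂.continuousAt.preimage_mem_nhds (hO.mem_nhds hxy)] with z hz hz'
  refine ⟨hg, hz ?_, hz'⟩
  change A.shift t' (A.shift p z.1.1) = A.shift t' (A.shift q z.1.2)
  rw [← shift_mul, ← shift_mul]
  change p' * t = p * t' at e
  change q' * t = q * t' at e'
  rw [← e, ← e', shift_mul, z.2, shift_mul]

/-- The largest open subset of `M_p × M_q` whose arrows belong to `B`. -/
def core (B : Set A.Arrow) (p q : P) : Set (A.M p × A.M q) :=
  ⋃₀ {O | IsOpen O ∧ A.arrows p q O ⊆ B}

theorem isOpen_core (B : Set A.Arrow) (p q : P) : IsOpen (A.core B p q) :=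
  isOpen_sUnion fun _ h => h.1

theorem arrows_core_subset (B : Set A.Arrow) (p q : P) : A.arrows p q (A.core B p q) ⊆ B := by
  rintro a ⟨hg, h, O, hO, ha⟩
  exact hO.2 ⟨hg, h, ha⟩

/-- An open set `B` of arrows is near `a ∈ B` described by coordinates in `M_{pc}` and `M_{qc}`,
for suitable `c`. -/
theorem exists_mem_arrows_core {B : Set A.Arrow} (hB : IsOpen B) {a : A.Arrow} (ha : a ∈ B)
    {p q : P} (hg : a.g = frac p q) (h : A.shift p a.x = A.shift q a.y) :
    ∃ c, a ∈ A.arrows (p * c) (q * c) (A.core B (p * c) (q * c)) := by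
  obtain ⟨x, g, y, hprop⟩ := a
  obtain rfl : g = frac p q := hg
  obtain ⟨O, hO, e⟩ := isOpen_induced_iff.1 (A.isOpen_arrow_iff.1 hB p q)
  have hmem : (x, y) ∈ O := by
    have : (⟨(x, y), h⟩ : {z : A.History × A.History // A.shift p z.1 = A.shift q z.2}) ∈
      Subtype.val ⁻¹' O := e ▸ ha
    exact this
  obtain ⟨N₁, N₂, h₁, h₂, hx, hy, hN⟩ := isOpen_prod_iff.1 hO x y hmem
  obtain ⟨k, n₁, hn₁, hk⟩ := A.mem_nhds_history_iff.1 (h₁.mem_nhds hx)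
  obtain ⟨l, n₂, hn₂, hl⟩ := A.mem_nhds_history_iff.1 (h₂.mem_nhds hy)
  obtain ⟨u, u', hu⟩ := RightOre.ore p k
  obtain ⟨v, v', hv⟩ := RightOre.ore (q * u) l
  obtain ⟨c, hc⟩ : ∃ c, c = u * v := ⟨_, rfl⟩
  have hkc : k * (u' * v) = p * c := by rw [hc, ← mul_assoc, ← hu, mul_assoc]
  have hlc : l * v' = q * c := by rw [hc, ← hv, mul_assoc]
  -- Injectivity on `N` lets an equality of shifts by `p * c` and `q * c` descend to one by `p` and
  -- `q`.
  obtain ⟨N, hNo, hNm, hinj⟩ := (A.isLocalHomeomorph_s c).exists_injOn ((A.shift p x).1 c)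
  let n : Set (A.M (p * c) × A.M (q * c)) :=
    {m | A.res _ hkc m.1 ∈ interior n₁ ∧ A.res _ hlc m.2 ∈ interior n₂ ∧
      A.ss p c m.1 ∈ N ∧ A.ss q c m.2 ∈ N}
  have hn : IsOpen n :=
    (isOpen_interior.preimage ((A.continuous_res _ hkc).comp continuous_fst)).inter
      ((isOpen_interior.preimage ((A.continuous_res _ hlc).comp continuous_snd)).inter
        ((hNo.preimage ((A.continuous_ss p c).comp continuous_fst)).inter
          (hNo.preimage ((A.continuous_ss q c).comp continuous_snd))))
  refine ⟨c, (frac_mul_right p q c).symm, ?_, n, ⟨hn, ?_⟩, ?_, ?_, ?_, ?_⟩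
  · rw [shift_mul, shift_mul]
    exact congrArg _ h
  · rintro ⟨x', g', y', hp'⟩ ⟨hg', hs', hk', hl', hN₁, hN₂⟩
    obtain rfl : g' = frac (p * c) (q * c) := hg'
    have hs : A.shift p x' = A.shift q y' := by
      simp only [shift_mul] at hs'
      exact A.eq_of_shift_eq hinj hN₁ hN₂ hs'
    have hz : (x', y') ∈ O := by
      refine hN ⟨hk ?_, hl ?_⟩
      · rw [A.res_history] at hk'
        exact (interior_subset hk' : x'.1 k ∈ n₁)
      · rw [A.res_history] at hl'
        exact (interior_subset hl' : y'.1 l ∈ n₂)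
    have : (⟨(x', y'), hs⟩ : {z : A.History × A.History // A.shift p z.1 = A.shift q z.2}) ∈
      {z | A.toArrow ⟨(p, q), z⟩ ∈ B} := e ▸ hz
    have heq : (⟨x', frac (p * c) (q * c), y', hp'⟩ : A.Arrow) =
        A.toArrow ⟨(p, q), ⟨(x', y'), hs⟩⟩ := Arrow.ext' A rfl (frac_mul_right p q c) rfl
    rw [heq]
    exact this
  · rw [A.res_history]
    exact mem_interior_iff_mem_nhds.2 hn₁
  · rw [A.res_history]
    exact mem_interior_iff_mem_nhds.2 hn₂
  · exact hNm
  · change (A.shift q y).1 c ∈ N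
    have h' : A.shift p x = A.shift q y := h
    rwa [← h']

/-- Lets finitely many arrow sets with the same group element be absorbed into one at a later level;
the factor `c` is again cancelled by local injectivity. -/
theorem arrows_core_mono (B : Set A.Arrow) (p q c : P) :
    A.arrows p q (A.core B p q) ⊆ A.arrows (p * c) (q * c) (A.core B (p * c) (q * c)) := by
  rintro ⟨x, g, y, hp⟩ ⟨hg, h, hmem⟩
  obtain rfl : g = frac p q := hg
  obtain ⟨N, hNo, hNm, hinj⟩ := (A.isLocalHomeomorph_s c).exists_injOn ((A.shift p x).1 c)
  let n : Set (A.M (p * c) × A.M (q * c)) :=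
    {m | (A.rr p c m.1, A.rr q c m.2) ∈ A.core B p q ∧ A.ss p c m.1 ∈ N ∧ A.ss q c m.2 ∈ N}
  have hn : IsOpen n :=
    ((A.isOpen_core B p q).preimage (((A.continuous_rr p c).comp continuous_fst).prodMk
      ((A.continuous_rr q c).comp continuous_snd))).inter
        ((hNo.preimage ((A.continuous_ss p c).comp continuous_fst)).inter
          (hNo.preimage ((A.continuous_ss q c).comp continuous_snd)))
  refine ⟨(frac_mul_right p q c).symm, ?_, n, ⟨hn, ?_⟩, ?_, ?_, ?_⟩
  · rw [shift_mul, shift_mul]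
    exact congrArg _ h
  · rintro ⟨x', g', y', hp'⟩ ⟨hg', hs', hk', hN₁, hN₂⟩
    refine A.arrows_core_subset B p q ⟨hg'.trans (frac_mul_right p q c), ?_, ?_⟩
    · simp only [shift_mul] at hs'
      exact A.eq_of_shift_eq hinj hN₁ hN₂ hs'
    · simp only [x'.2 p c, y'.2 q c] at hk'
      exact hk'
  · simp only [x.2 p c, y.2 q c]
    exact hmem
  · exact hNm
  · change (A.shift q y).1 c ∈ N
    have h' : A.shift p x = A.shift q y := h
    rwa [← h']

end CorrAction

/-! ### Finite-level fibre products and compactness -/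

namespace CorrAction

variable {P : Type*} [Monoid P] {X : Type*} [TopologicalSpace X] (A : CorrAction P X)

/-- The map `M'_p → X'` induced by `s_p`. -/
def sPos (p : P) (m : A.MPos p) : A.possible := ⟨A.s p m.1, m.2⟩

theorem continuous_sPos (p : P) : Continuous (A.sPos p) :=
  ((A.continuous_s p).comp continuous_subtype_val).subtype_mk _

theorem isOpenMap_sPos (p : P) : IsOpenMap (A.sPos p) :=
  (A.isLocalHomeomorph_s p).isOpenMap.restrictPreimage A.possible

/-- The part of the fibre product of `M'_p` and `M'_q` in `O`. -/
def fibre (p q : P) (O : Set (A.M p × A.M q)) : Set (A.MPos p × A.MPos q) :=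
  {w | (w.1.1, w.2.1) ∈ O ∧ A.sPos p w.1 = A.sPos q w.2}

theorem s_eq_of_mem_fibre {p q : P} {O : Set (A.M p × A.M q)} {w : A.MPos p × A.MPos q}
    (hw : w ∈ A.fibre p q O) : A.s p w.1.1 = A.s q w.2.1 := congrArg Subtype.val hw.2

theorem isOpenMap_fst_fibre {p q : P} {O : Set (A.M p × A.M q)} (hO : IsOpen O) :
    IsOpenMap fun w : A.fibre p q O => w.1.1 := by
  intro T hT
  obtain ⟨T', hT', rfl⟩ := isOpen_induced_iff.1 hT
  have hO' : IsOpen {w : A.MPos p × A.MPos q | (w.1.1, w.2.1) ∈ O} :=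
    hO.preimage (continuous_subtype_val.prodMap continuous_subtype_val)
  convert isOpen_image_fst_of_eq (A.continuous_sPos p) (A.isOpenMap_sPos q) (hT'.inter hO') using 1
  ext m
  constructor
  · rintro ⟨w, hw, rfl⟩
    exact ⟨w.1, ⟨⟨hw, w.2.1⟩, w.2.2⟩, rfl⟩
  · rintro ⟨w, ⟨⟨h, h'⟩, h''⟩, rfl⟩
    exact ⟨⟨w, h', h''⟩, h, rfl⟩

theorem isOpenMap_snd_fibre {p q : P} {O : Set (A.M p × A.M q)} (hO : IsOpen O) :
    IsOpenMap fun w : A.fibre p q O => w.1.2 := by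
  intro T hT
  obtain ⟨T', hT', rfl⟩ := isOpen_induced_iff.1 hT
  have hO' : IsOpen {w : A.MPos p × A.MPos q | (w.1.1, w.2.1) ∈ O} :=
    hO.preimage (continuous_subtype_val.prodMap continuous_subtype_val)
  convert isOpen_image_snd_of_eq (A.isOpenMap_sPos p) (A.continuous_sPos q) (hT'.inter hO') using 1
  ext m
  constructor
  · rintro ⟨w, hw, rfl⟩
    exact ⟨w.1, ⟨⟨hw, w.2.1⟩, w.2.2⟩, rfl⟩
  · rintro ⟨w, ⟨⟨h, h'⟩, h''⟩, rfl⟩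
    exact ⟨⟨w, h', h''⟩, h, rfl⟩

/-- A subset of the fibre product with open second projection is open. -/
theorem exists_eq_fibre {p q : P} {W : Set (A.MPos p × A.MPos q)}
    (hs : ∀ w ∈ W, A.s p w.1.1 = A.s q w.2.1) (hW : IsOpenMap fun w : W => w.1.2) :
    ∃ O, IsOpen O ∧ W = A.fibre p q O := by
  refine ⟨⋃₀ {O | IsOpen O ∧ A.fibre p q O ⊆ W}, isOpen_sUnion fun _ h => h.1,
    Subset.antisymm (fun w hw => ?_) ?_⟩
  · obtain ⟨N, hN, hwN, hinj⟩ := (A.isLocalHomeomorph_s p).exists_injOn w.1.1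
    have hT : IsOpen {v : W | v.1.1.1 ∈ N} := hN.preimage
      (continuous_subtype_val.comp (continuous_fst.comp continuous_subtype_val))
    -- `D` cuts out the second coordinates of points of `W` whose first coordinate lies in `N`. Any
    -- point of the fibre product in `N × D` shares its second coordinate with such a point, hence
    -- also its first by injectivity of `s_p` on `N`.
    obtain ⟨D, hD, hDe⟩ := isOpen_induced_iff.1 (hW _ hT)
    have hwD : w.2 ∈ Subtype.val ⁻¹' D := hDe ▸ ⟨⟨w, hw⟩, hwN, rfl⟩
    refine ⟨⟨N ×ˢ D, ⟨hN.prod hD, ?_⟩, hwN, hwD⟩, Subtype.ext (hs w hw)⟩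
    rintro ⟨m, m'⟩ ⟨⟨hm, hm'⟩, h⟩
    have : m' ∈ Subtype.val ⁻¹' D := hm'
    rw [hDe] at this
    obtain ⟨⟨⟨v, v'⟩, hv⟩, hvN, rfl⟩ := this
    have hmv : m = v := Subtype.ext (hinj hm hvN
      ((congrArg Subtype.val h).trans (hs (v, v') hv).symm))
    rwa [hmv]
  · rintro w ⟨⟨O, hO, hwO⟩, h⟩
    exact hO.2 ⟨hwO, h⟩

variable [RightOre P]

open FracGroup

/-- Compact sets in `H⁰` can be separated from complements of open sets at some level `k`. -/
theorem exists_level {K V : Set A.History} (hK : IsCompact K) (hV : IsOpen V) (hKV : K ⊆ V) :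
    ∃ (k : P) (N L : Set (A.M k)), IsOpen N ∧ IsClosed L ∧ N ⊆ L ∧
      (∀ x ∈ K, x.1 k ∈ N) ∧ ∀ x : A.History, x.1 k ∈ L → x ∈ V := by
  refine hK.induction_on (p := fun K => ∃ (k : P) (N L : Set (A.M k)), IsOpen N ∧ IsClosed L ∧
    N ⊆ L ∧ (∀ x ∈ K, x.1 k ∈ N) ∧ ∀ x : A.History, x.1 k ∈ L → x ∈ V) ?_ ?_ ?_ ?_
  · exact ⟨1, ∅, ∅, isOpen_empty, isClosed_empty, Subset.rfl, by simp, by simp⟩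
  · rintro s t hst ⟨k, N, L, hN, hL, hNL, ht, hV⟩
    exact ⟨k, N, L, hN, hL, hNL, fun x hx => ht x (hst hx), hV⟩
  · rintro s t ⟨k, N, L, hN, hL, hNL, hs, hV⟩ ⟨k', N', L', hN', hL', hNL', ht, hV'⟩
    obtain ⟨c, d, h⟩ := RightOre.ore k k'
    refine ⟨k * c, A.res c rfl ⁻¹' N ∪ A.res d h.symm ⁻¹' N',
      A.res c rfl ⁻¹' L ∪ A.res d h.symm ⁻¹' L',
      (hN.preimage (A.continuous_res _ _)).union (hN'.preimage (A.continuous_res _ _)),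
      (hL.preimage (A.continuous_res _ _)).union (hL'.preimage (A.continuous_res _ _)),
      union_subset_union (preimage_mono hNL) (preimage_mono hNL'), ?_, ?_⟩
    · rintro x (hx | hx)
      · left
        rw [mem_preimage, A.res_history]
        exact hs x hx
      · right
        rw [mem_preimage, A.res_history]
        exact ht x hx
    · rintro x (hx | hx)
      · rw [mem_preimage, A.res_history] at hx
        exact hV x hx
      · rw [mem_preimage, A.res_history] at hx
        exact hV' x hx
  · intro x hx
    obtain ⟨k, N, hN, hNV⟩ := A.mem_nhds_history_iff.1 (hV.mem_nhds (hKV hx))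
    obtain ⟨L, hL, hLc, hLN⟩ := exists_mem_nhds_isClosed_subset hN
    refine ⟨_, mem_nhdsWithin_of_mem_nhds ((A.continuous_history k).continuousAt
      (interior_mem_nhds.2 hL)),
      k, interior L, L, isOpen_interior, hLc, interior_subset, fun y hy => hy,
      fun y hy => hNV (hLN hy)⟩

/-- Equal fractions have a common expansion, so one representative of `g` lies beyond all those in
`F`. This is what later allows one arrow set for each group element, as (LC6) demands. -/
theorem exists_frac_dominating (F : Finset (P × P)) (g : FracGroup P) :
    ∃ p q : P, frac p q = g ∧ ∀ x ∈ F, frac x.1 x.2 = g → ∃ c, x.1 * c = p ∧ x.2 * c = q := by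
  classical
  induction F using Finset.induction_on with
  | empty =>
    obtain ⟨p, q, rfl⟩ := exists_frac g
    exact ⟨p, q, rfl, by simp⟩
  | insert x F _ ih =>
    obtain ⟨p, q, hg, hF⟩ := ih
    by_cases hx : frac x.1 x.2 = g
    · obtain ⟨t, t', e, e'⟩ := frac_eq_iff.1 (hx.trans hg.symm)
      refine ⟨p * t', q * t', (frac_mul_right _ _ _).trans hg, fun y hy hyg => ?_⟩
      rcases Finset.mem_insert.1 hy with rfl | hy
      · exact ⟨t, e, e'⟩
      · obtain ⟨c, rfl, rfl⟩ := hF y hy hyg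
        exact ⟨c * t', (mul_assoc _ _ _).symm, (mul_assoc _ _ _).symm⟩
    · refine ⟨p, q, hg, fun y hy hyg => ?_⟩
      rcases Finset.mem_insert.1 hy with rfl | hy
      · exact absurd hyg hx
      · exact hF y hy hyg

/-- Finitely many group elements suffice to cover a compact set by a bisection, and each
contributes a single set of arrows, described at a level beyond `k`. -/
theorem exists_finite_cover {B : Set A.Arrow} (hB : IsOpen B) {C : Set A.History}
    (hC : IsCompact C) (hCB : C ⊆ Arrow.y '' B) (k : P) :
    ∃ (n : ℕ) (p q a b d : Fin n → P) (e : P), (∀ i, p i * a i = e) ∧ (∀ i, q i * b i = e) ∧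
      (∀ i, k * d i = q i) ∧ (∀ i j, i ≠ j → frac (p i) (q i) ≠ frac (p j) (q j)) ∧
      ∀ x ∈ C, ∃ i, ∃ β ∈ A.arrows (p i) (q i) (A.core B (p i) (q i)), β.y = x := by
  classical
  obtain ⟨F, hF⟩ := hC.elim_finite_subcover
    (fun z : P × P => Arrow.y '' A.arrows z.1 z.2 (A.core B z.1 z.2))
    (fun z => A.isOpenMap_source _ (A.isOpen_arrows _ _ (A.isOpen_core B _ _))) (by
      intro x hx
      obtain ⟨β, hβ, rfl⟩ := hCB hx
      obtain ⟨p, q, hg, hs⟩ := β.prop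
      obtain ⟨c, hc⟩ := A.exists_mem_arrows_core hB hβ hg hs
      exact mem_iUnion.2 ⟨(p * c, q * c), β, hc, rfl⟩)
  have h₁ : ∀ g, ∃ p q d : P, k * d = q ∧ frac p q = g ∧
      ∀ x ∈ F, frac x.1 x.2 = g → ∃ c, x.1 * c = p ∧ x.2 * c = q := by
    intro g
    obtain ⟨p, q, hg, h⟩ := exists_frac_dominating F g
    -- Expanding the fraction by `u` pushes its denominator beyond `k`.
    obtain ⟨u, v, huv⟩ := RightOre.ore q k
    refine ⟨p * u, q * u, v, huv.symm, (frac_mul_right _ _ _).trans hg, fun x hx hxg => ?_⟩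
    obtain ⟨c, rfl, rfl⟩ := h x hx hxg
    exact ⟨c * u, (mul_assoc _ _ _).symm, (mul_assoc _ _ _).symm⟩
  choose p q d hd hg hdom using h₁
  let Γ : Finset (FracGroup P) := F.image fun z => frac z.1 z.2
  obtain ⟨e, he⟩ := RightOre.exists_common_multiple (Γ.image p ∪ Γ.image q)
  choose! f hf using he
  let φ : Fin Γ.card → FracGroup P := fun i => Γ.equivFin.symm i
  have hφ : ∀ i, φ i ∈ Γ := fun i => (Γ.equivFin.symm i).2
  refine ⟨Γ.card, fun i => p (φ i), fun i => q (φ i), fun i => f (p (φ i)), fun i => f (q (φ i)),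
    fun i => d (φ i), e, fun i => ?_, fun i => ?_, fun i => hd _, fun i j hij => ?_,
    fun x hx => ?_⟩
  · exact hf _ (Finset.mem_union_left _ (Finset.mem_image_of_mem _ (hφ i)))
  · exact hf _ (Finset.mem_union_right _ (Finset.mem_image_of_mem _ (hφ i)))
  · rw [hg, hg]
    exact fun h => hij (Γ.equivFin.symm.injective (Subtype.ext h))
  · obtain ⟨z, hz, β, hβ, rfl⟩ := mem_iUnion₂.1 (hF hx)
    have hzΓ : frac z.1 z.2 ∈ Γ := Finset.mem_image_of_mem (fun z : P × P => frac z.1 z.2) hz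
    refine ⟨Γ.equivFin ⟨_, hzΓ⟩, β, ?_, rfl⟩
    have hφz : φ (Γ.equivFin ⟨_, hzΓ⟩) = frac z.1 z.2 := by simp [φ]
    obtain ⟨c, h₁, h₂⟩ := hdom _ z hz hφz.symm
    change β ∈ A.arrows (p (φ _)) (q (φ _)) (A.core B (p (φ _)) (q (φ _)))
    rw [← h₁, ← h₂]
    exact A.arrows_core_mono B z.1 z.2 c hβ

/-- Points of the fibre product lift to arrows. -/
theorem exists_arrow_of_mem_fibre {p q : P} {O : Set (A.M p × A.M q)}
    {w : A.MPos p × A.MPos q} (hw : w ∈ A.fibre p q O) {y : A.History} (hy : A.pos q y = w.2) :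
    ∃ β ∈ A.arrows p q O, A.pos p β.x = w.1 ∧ β.y = y := by
  have hy' : y.1 q = w.2.1 := congrArg Subtype.val hy
  obtain ⟨x, hx, hs⟩ := A.exists_glue (p := p) (m := w.1.1) (z := A.shift q y) (by
    rw [base_shift, hy', A.s_eq_of_mem_fibre hw])
  refine ⟨A.mkArrow p q hs, ⟨rfl, hs, ?_⟩, Subtype.ext hx, rfl⟩
  change (x.1 p, y.1 q) ∈ O
  rw [hx, hy']
  exact hw.1

theorem exists_arrow_of_mem_fibre' {p q : P} {O : Set (A.M p × A.M q)}
    {w : A.MPos p × A.MPos q} (hw : w ∈ A.fibre p q O) {x : A.History} (hx : A.pos p x = w.1) :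
    ∃ β ∈ A.arrows p q O, A.pos q β.y = w.2 ∧ β.x = x := by
  have hx' : x.1 p = w.1.1 := congrArg Subtype.val hx
  obtain ⟨y, hy, hs⟩ := A.exists_glue (p := q) (m := w.2.1) (z := A.shift p x) (by
    rw [base_shift, hx', A.s_eq_of_mem_fibre hw])
  refine ⟨A.mkArrow p q hs.symm, ⟨rfl, hs.symm, ?_⟩, Subtype.ext hy, rfl⟩
  change (x.1 p, y.1 q) ∈ O
  rw [hy, hx']
  exact hw.1

theorem mem_fibre_of_mem_arrows {p q : P} {O : Set (A.M p × A.M q)} {β : A.Arrow}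
    (hβ : β ∈ A.arrows p q O) : (A.pos p β.x, A.pos q β.y) ∈ A.fibre p q O := by
  refine ⟨hβ.2.2, Subtype.ext ?_⟩
  change A.s p (β.x.1 p) = A.s q (β.y.1 q)
  rw [← base_shift, ← base_shift, hβ.2.1]

theorem pos_mem_image_fst_iff {p q : P} {O : Set (A.M p × A.M q)} {x : A.History} :
    A.pos p x ∈ Prod.fst '' A.fibre p q O ↔ ∃ β ∈ A.arrows p q O, β.x = x := by
  constructor
  · rintro ⟨w, hw, h⟩
    obtain ⟨β, hβ, -, h'⟩ := A.exists_arrow_of_mem_fibre' hw h.symm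
    exact ⟨β, hβ, h'⟩
  · rintro ⟨β, hβ, rfl⟩
    exact ⟨_, A.mem_fibre_of_mem_arrows hβ, rfl⟩

theorem pos_mem_image_snd_iff {p q : P} {O : Set (A.M p × A.M q)} {y : A.History} :
    A.pos q y ∈ Prod.snd '' A.fibre p q O ↔ ∃ β ∈ A.arrows p q O, β.y = y := by
  constructor
  · rintro ⟨w, hw, h⟩
    obtain ⟨β, hβ, -, h'⟩ := A.exists_arrow_of_mem_fibre hw h.symm
    exact ⟨β, hβ, h'⟩
  · rintro ⟨β, hβ, rfl⟩
    exact ⟨_, A.mem_fibre_of_mem_arrows hβ, rfl⟩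

end CorrAction

/-! ### From a contracting groupoid to a contracting action -/

namespace CorrAction

variable {P : Type*} [Monoid P] [RightOre P] {X : Type*} [TopologicalSpace X]

open FracGroup

theorem locallyContracting_of_groupoid [T2Space X] (A : CorrAction P X)
    (H : A.transformationGroupoid.LocallyContracting) : A.LocallyContracting := by
  intro S hS hSc ⟨x₀, hx₀⟩
  obtain ⟨S', hS', rfl⟩ := isOpen_induced_iff.1 hS
  obtain ⟨z₀, hz₀⟩ := A.exists_base_eq x₀.2
  obtain ⟨V, B, hVo, hVU, hB, hVB, hBV⟩ := H (A.base ⁻¹' S') (hS'.preimage A.continuous_base)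
    ⟨z₀, show A.base z₀ ∈ S' from hz₀ ▸ hx₀⟩
  change Set A.History at V
  change Set A.Arrow at B
  obtain ⟨hBo, hBr, hBs⟩ := A.isBisection_iff.1 hB
  change closure V ⊆ Arrow.y '' B at hVB
  change Arrow.x '' {b ∈ B | b.y ∈ closure V} ⊂ V at hBV
  have hVo' : IsOpen V := hVo
  have hVU' : V ⊆ A.base ⁻¹' S' := hVU
  have hcl : IsCompact (closure V) := by
    have hc := A.isCompact_base_preimage (hSc.image continuous_subtype_val)
    refine hc.closure_of_subset fun x hx => ?_
    exact ⟨⟨A.base x, A.base_mem_possible x⟩, subset_closure (hVU' hx), rfl⟩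
  -- the image of a compact subset of the domain of the bisection is compact
  have himage : ∀ C, IsCompact C → C ⊆ Arrow.y '' B → IsCompact (Arrow.x '' {b ∈ B | b.y ∈ C}) := by
    intro C hC hCB
    have hemb : IsOpenEmbedding (B.domRestrict (Arrow.y (A := A))) := hB.2.2
    have h₁ := hemb.isInducing.isCompact_preimage' hC (by
      rintro x hx
      obtain ⟨b, hb, rfl⟩ := hCB hx
      exact ⟨⟨b, hb⟩, rfl⟩)
    have h₂ := h₁.image (A.continuous_range.comp continuous_subtype_val)
    convert h₂ using 1
    ext x
    constructor
    · rintro ⟨b, ⟨hb, hbC⟩, rfl⟩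
      exact ⟨⟨b, hb⟩, hbC, rfl⟩
    · rintro ⟨b, hbC, rfl⟩
      exact ⟨b.1, ⟨b.2, hbC⟩, rfl⟩
  obtain ⟨v, hv, hvL⟩ := exists_of_ssubset hBV
  -- The point `v` of `V` missed by the contraction is added to the compact set, so that it lies
  -- over `N` and can later witness strictness.
  obtain ⟨k, N, L, hN, hL, hNL, hKN, hLV⟩ := A.exists_level
    ((himage _ hcl hVB).insert v) hVo' (insert_subset hv hBV.1)
  set C : Set A.History := (fun x : A.History => x.1 k) ⁻¹' L with hCdef
  have hCV : C ⊆ V := fun x hx => hLV x hx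
  have hC : IsCompact C := hcl.of_isClosed_subset (hL.preimage (A.continuous_history k))
    (hCV.trans subset_closure)
  have hCB : C ⊆ Arrow.y '' B := (hCV.trans subset_closure).trans hVB
  obtain ⟨n, p, q, a, b, d, e, hp, hq, hd, hne, hcov⟩ := A.exists_finite_cover hBo hC hCB k
  -- Sources are cut down to the cylinder over `N`, so that together they fill it exactly; the
  -- condition is visible at level `q i`, which lies beyond `k`.
  let O : ∀ i, Set (A.M (p i) × A.M (q i)) := fun i =>
    A.core B (p i) (q i) ∩ {m | A.res (d i) (hd i) m.2 ∈ N}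
  have hO : ∀ i, IsOpen (O i) := fun i =>
    (A.isOpen_core B _ _).inter (hN.preimage ((A.continuous_res _ _).comp continuous_snd))
  have hOB : ∀ i, ∀ β ∈ A.arrows (p i) (q i) (O i), β ∈ B ∧ β.y.1 k ∈ N := by
    rintro i β ⟨h₁, h₂, h₃, h₄⟩
    refine ⟨A.arrows_core_subset B _ _ ⟨h₁, h₂, h₃⟩, ?_⟩
    rw [← A.res_history β.y (d i) (hd i)]
    exact h₄
  have hZ : ∀ x : A.History, A.pos e x ∈ ⋃ i, A.extend (hq i) (Prod.snd '' A.fibre _ _ (O i)) ↔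
      x.1 k ∈ N := by
    intro x
    simp only [mem_iUnion, A.mem_extend_iff, A.pos_mem_image_snd_iff]
    constructor
    · rintro ⟨i, β, hβ, rfl⟩
      exact (hOB i β hβ).2
    · intro hx
      obtain ⟨i, β, ⟨h₁, h₂, h₃⟩, rfl⟩ := hcov x (hNL hx)
      refine ⟨i, β, ⟨h₁, h₂, h₃, ?_⟩, rfl⟩
      change A.res (d i) (hd i) (β.y.1 (q i)) ∈ N
      rwa [A.res_history]
  -- This image of a compact set is closed in `M'_e`, which bounds the closure of the ranges;
  -- compactness of `C` is why `L` is used beside `N`.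
  have hD : IsCompact (A.pos e '' (Arrow.x '' {b ∈ B | b.y ∈ C})) :=
    (himage C hC hCB).image (A.continuous_pos e)
  have hYD : closure (⋃ i, A.extend (hp i) (Prod.fst '' A.fibre _ _ (O i))) ⊆
      A.pos e '' (Arrow.x '' {b ∈ B | b.y ∈ C}) := by
    refine closure_minimal ?_ hD.isClosed
    intro m hm
    obtain ⟨x, rfl⟩ := A.exists_pos_eq m
    simp only [mem_iUnion, A.mem_extend_iff, A.pos_mem_image_fst_iff] at hm
    obtain ⟨i, β, hβ, rfl⟩ := hm
    exact ⟨_, ⟨β, ⟨(hOB i β hβ).1, hNL (hOB i β hβ).2⟩, rfl⟩, rfl⟩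
  have hsub : ∀ x ∈ Arrow.x '' {b ∈ B | b.y ∈ C}, x ∈ Arrow.x '' {b ∈ B | b.y ∈ closure V} := by
    rintro _ ⟨β, ⟨h₁, h₂⟩, rfl⟩
    exact ⟨β, ⟨h₁, subset_closure (hCV h₂)⟩, rfl⟩
  refine ⟨n, p, q, a, b, fun i => A.fibre (p i) (q i) (O i), e, hp, hq,
    fun i w hw => A.s_eq_of_mem_fibre hw,
    fun i => ⟨?_, A.isOpenMap_fst_fibre (hO i), ?_, A.isOpenMap_snd_fibre (hO i)⟩,
    fun i j hij => ?_, fun i j hij => ?_, ⟨?_, fun hcon => ?_⟩, fun i w hw => ?_, hne⟩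
  · rintro ⟨w, hw⟩ ⟨w', hw'⟩ h
    change w.1 = w'.1 at h
    obtain ⟨x, hx⟩ := A.exists_pos_eq w.1
    obtain ⟨β, hβ, h₁, h₂⟩ := A.exists_arrow_of_mem_fibre' hw hx
    obtain ⟨β', hβ', h₁', h₂'⟩ := A.exists_arrow_of_mem_fibre' hw' (hx.trans h)
    have := hBr (hOB i β hβ).1 (hOB i β' hβ').1 (h₂.trans h₂'.symm)
    exact Subtype.ext (Prod.ext h (by rw [← h₁, ← h₁', this]))
  · rintro ⟨w, hw⟩ ⟨w', hw'⟩ h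
    change w.2 = w'.2 at h
    obtain ⟨x, hx⟩ := A.exists_pos_eq w.2
    obtain ⟨β, hβ, h₁, h₂⟩ := A.exists_arrow_of_mem_fibre hw hx
    obtain ⟨β', hβ', h₁', h₂'⟩ := A.exists_arrow_of_mem_fibre hw' (hx.trans h)
    have := hBs (hOB i β hβ).1 (hOB i β' hβ').1 (h₂.trans h₂'.symm)
    exact Subtype.ext (Prod.ext (by rw [← h₁, ← h₁', this]) h)
  · rw [Set.disjoint_left]
    intro m hm hm'
    obtain ⟨x, rfl⟩ := A.exists_pos_eq m
    rw [A.mem_extend_iff, A.pos_mem_image_fst_iff] at hm hm'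
    obtain ⟨β, hβ, h₁⟩ := hm
    obtain ⟨β', hβ', h₁'⟩ := hm'
    have := hBr (hOB i β hβ).1 (hOB j β' hβ').1 (h₁.trans h₁'.symm)
    exact hne i j hij (by rw [← hβ.1, ← hβ'.1, this])
  · rw [Set.disjoint_left]
    intro m hm hm'
    obtain ⟨x, rfl⟩ := A.exists_pos_eq m
    rw [A.mem_extend_iff, A.pos_mem_image_snd_iff] at hm hm'
    obtain ⟨β, hβ, h₁⟩ := hm
    obtain ⟨β', hβ', h₁'⟩ := hm'
    have := hBs (hOB i β hβ).1 (hOB j β' hβ').1 (h₁.trans h₁'.symm)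
    exact hne i j hij (by rw [← hβ.1, ← hβ'.1, this])
  · intro m hm
    obtain ⟨x, hx, rfl⟩ := hYD hm
    exact (hZ x).2 (hKN x (mem_insert_of_mem _ (hsub x hx)))
  · obtain ⟨_, ⟨β, ⟨hβB, hβC⟩, rfl⟩, hβv⟩ :=
      hYD (hcon ((hZ v).2 (hKN v (mem_insert _ _))))
    obtain ⟨i, β', ⟨hg, hs, hm⟩, hβ'⟩ := hcov _ hβC
    obtain rfl : β' = β := hBs (A.arrows_core_subset B _ _ ⟨hg, hs, hm⟩) hβB hβ'
    have hvp : v.1 (p i) = β'.x.1 (p i) := by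
      have h := congrArg Subtype.val hβv
      change β'.x.1 e = v.1 e at h
      rw [← A.res_history v (a i) (hp i), ← h, A.res_history]
    -- Since `v` agrees with the range of `β'` at level `p i`, the arrow can be moved to have range
    -- `v`. Its source keeps its coordinate at `q i`, hence at `k`, so it stays in `C`, against the
    -- choice of `v`.
    obtain ⟨y, hy, hys⟩ := A.exists_glue (p := q i) (m := β'.y.1 (q i)) (z := A.shift (p i) v) (by
      rw [base_shift, hvp, ← base_shift, ← base_shift, hs])
    have hyk : y.1 k = β'.y.1 k := by
      rw [← A.res_history y (d i) (hd i), hy, A.res_history]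
    refine hvL (hsub v ⟨A.mkArrow (p i) (q i) hys.symm,
      ⟨A.arrows_core_subset B _ _ ⟨rfl, hys.symm, ?_⟩, ?_⟩, rfl⟩)
    · change (v.1 (p i), y.1 (q i)) ∈ _
      rw [hvp, hy]
      exact hm
    · change y.1 k ∈ L
      rw [hyk]
      exact hβC
  · obtain ⟨y, hy⟩ := A.exists_pos_eq w.2
    obtain ⟨β, hβ, -, rfl⟩ := A.exists_arrow_of_mem_fibre hw hy
    have h₁ : A.base β.y ∈ S' := hVU' (hLV _ (hNL (hOB i β hβ).2))
    refine ⟨⟨A.base β.y, A.base_mem_possible _⟩, h₁, ?_⟩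
    rw [← hy]
    exact (A.r_history β.y (q i)).symm

end CorrAction

/-! ### Conjugation, and from a contracting action to a contracting groupoid -/

namespace FracGroup

variable {P : Type*} [Monoid P] [RightOre P]

theorem frac_mul_left (t p q : P) :
    frac (t * p) (t * q) = frac t 1 * frac p q * (frac t 1)⁻¹ := by
  rw [inv_frac, frac_mul_frac (t₁ := p) (t₂ := 1) (by simp),
    frac_mul_frac (t₁ := 1) (t₂ := q) (by simp), mul_one]

/-- Once `p` and `q` are expanded by a common `u` to multiples of `t`, conjugation just strips `t`
from both. The explicit `c`, `d` make conjugation of arrows continuous on each piece of `H¹`. -/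
theorem exists_conj_frac (t p q : P) : ∃ c d u : P, t * c = p * u ∧ t * d = q * u ∧
    (frac t 1)⁻¹ * frac p q * frac t 1 = frac c d := by
  obtain ⟨c, u, h⟩ := RightOre.ore t p
  obtain ⟨d, v, k⟩ := RightOre.ore t (q * u)
  have h₁ : t * (c * v) = p * (u * v) := by rw [← mul_assoc, h, mul_assoc]
  have h₂ : t * d = q * (u * v) := by rw [k, mul_assoc]
  refine ⟨c * v, d, u * v, h₁, h₂, ?_⟩
  rw [← frac_mul_right p q (u * v), ← h₁, ← h₂, frac_mul_left]
  group

end FracGroup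

namespace CorrAction

variable {P : Type*} [Monoid P] [RightOre P] {X : Type*} [TopologicalSpace X]
  (A : CorrAction P X)

open FracGroup

/-- Conjugation by the arrows `(x, t, s̃_t(x))`. -/
noncomputable def conj (t : P) (a : A.Arrow) : A.Arrow :=
  ⟨A.shift t a.x, (frac t 1)⁻¹ * a.g * frac t 1, A.shift t a.y, by
    obtain ⟨p, q, hg, h⟩ := a.prop
    obtain ⟨c, d, u, hc, hd, he⟩ := exists_conj_frac t p q
    refine ⟨c, d, by rw [hg, he], ?_⟩
    rw [← shift_mul, ← shift_mul, hc, hd, shift_mul, shift_mul, h]⟩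

theorem continuous_conj (t : P) : Continuous (A.conj t) := by
  refine A.continuous_arrow_iff.2 fun p q => ?_
  obtain ⟨c, d, u, hc, hd, he⟩ := exists_conj_frac t p q
  have hs : ∀ z : {z : A.History × A.History // A.shift p z.1 = A.shift q z.2},
      A.shift c (A.shift t z.1.1) = A.shift d (A.shift t z.1.2) := fun z => by
    rw [← shift_mul, ← shift_mul, hc, hd, shift_mul, shift_mul, z.2]
  have hcont : Continuous fun z : {z : A.History × A.History // A.shift p z.1 = A.shift q z.2} =>
      (⟨(A.shift t z.1.1, A.shift t z.1.2), hs z⟩ :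
        {z : A.History × A.History // A.shift c z.1 = A.shift d z.2}) :=
    (((A.continuous_shift t).comp (continuous_fst.comp continuous_subtype_val)).prodMk
      ((A.continuous_shift t).comp (continuous_snd.comp continuous_subtype_val))).subtype_mk _
  convert (A.continuous_toArrow c d).comp hcont using 1
  funext z
  exact Arrow.ext' A rfl he rfl

/-- Arrows lift along `conj t` once the range and source are lifted. -/
theorem exists_conj_eq (t : P) (b : A.Arrow) {x y : A.History} (hx : A.shift t x = b.x)
    (hy : A.shift t y = b.y) : ∃ a : A.Arrow, a.x = x ∧ a.y = y ∧ A.conj t a = b := by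
  obtain ⟨p, q, hg, h⟩ := b.prop
  have hs : A.shift (t * p) x = A.shift (t * q) y := by rw [shift_mul, shift_mul, hx, hy, h]
  refine ⟨A.mkArrow _ _ hs, rfl, rfl, Arrow.ext' A hx ?_ hy⟩
  change (frac t 1)⁻¹ * frac (t * p) (t * q) * frac t 1 = b.g
  rw [frac_mul_left, hg]
  group

theorem eq_of_conj_eq {t : P} {N : Set (A.M t)} (hN : InjOn (A.s t) N) {a b : A.Arrow}
    (hax : a.x.1 t ∈ N) (hay : a.y.1 t ∈ N) (hbx : b.x.1 t ∈ N) (hby : b.y.1 t ∈ N)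
    (h : A.conj t a = A.conj t b) : a = b := by
  refine Arrow.ext' A ?_ ?_ ?_
  · exact A.eq_of_shift_eq hN hax hbx (congrArg Arrow.x h)
  · have hg : (frac t 1)⁻¹ * a.g * frac t 1 = (frac t 1)⁻¹ * b.g * frac t 1 := congrArg Arrow.g h
    exact mul_left_cancel (mul_right_cancel hg)
  · exact A.eq_of_shift_eq hN hay hby (congrArg Arrow.y h)

theorem groupoid_locallyContracting [T2Space X] [LocallyCompactSpace X]
    (H : A.LocallyContracting) : A.transformationGroupoid.LocallyContracting := by
  rintro U hU ⟨x₀, hx₀⟩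
  change Set A.History at U
  change A.History at x₀
  have hU' : IsOpen U := hU
  obtain ⟨t, N₁, hN₁, hN₁U⟩ := A.mem_nhds_history_iff.1 (hU'.mem_nhds hx₀)
  obtain ⟨N₂, hN₂, hxN₂, hinj₂⟩ := (A.isLocalHomeomorph_s t).exists_injOn (x₀.1 t)
  obtain ⟨K, hK, hKN, hKc⟩ := local_compact_nhds (Filter.inter_mem hN₁ (hN₂.mem_nhds hxN₂))
  have hinj : InjOn (A.s t) K := hinj₂.mono (hKN.trans inter_subset_right)
  set N := interior K with hNdef
  have hN : IsOpen N := isOpen_interior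
  have hNK : N ⊆ K := interior_subset
  have hinjN : InjOn (A.s t) N := hinj.mono hNK
  have hNU : ∀ x : A.History, x.1 t ∈ N → x ∈ U := fun x hx => hN₁U (hKN (hNK hx)).1
  have hsN : IsOpen (A.s t '' N) := (A.isLocalHomeomorph_s t).isOpenMap _ hN
  have hsK : IsCompact (A.s t '' K) := hKc.image (A.continuous_s t)
  -- Histories based in `S` are exactly the `t`-shifts of histories with `t`-coordinate in `N`, all
  -- of which lie in `U`.
  let S : Set A.possible := Subtype.val ⁻¹' (A.s t '' N)
  have hKS : closure S ⊆ Subtype.val ⁻¹' (A.s t '' K) :=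
    closure_minimal (preimage_mono (image_mono hNK))
      (hsK.isClosed.preimage continuous_subtype_val)
  have hSc : IsCompact (closure S) :=
    (A.isClosed_possible.isClosedEmbedding_subtypeVal.isCompact_preimage
      hsK).of_isClosed_subset isClosed_closure hKS
  -- points of `H⁰` over `S` lift uniquely
  have hlift : ∀ z : A.History, A.base z ∈ A.s t '' N → ∃ x : A.History, x.1 t ∈ N ∧
      A.shift t x = z := by
    rintro z ⟨m, hm, h⟩
    obtain ⟨x, hx, hxz⟩ := A.exists_glue h
    exact ⟨x, hx ▸ hm, hxz⟩
  obtain ⟨n, p, q, a, b, W, e, hp, hq, hWs, hW, hdY, hdZ, hYZ, hWS, -⟩ := H S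
    (hsN.preimage continuous_subtype_val) hSc
    ⟨⟨A.base (A.shift t x₀), A.base_mem_possible _⟩, x₀.1 t, mem_interior_iff_mem_nhds.2 hK,
      (A.base_shift t x₀).symm⟩
  choose O hO hWO using fun i => A.exists_eq_fibre (hWs i) (hW i).2.2.2
  let B₀ : Set A.Arrow := ⋃ i, A.arrows (p i) (q i) (O i)
  have hB₀ : IsOpen B₀ := isOpen_iUnion fun i => A.isOpen_arrows _ _ (hO i)
  set Y := ⋃ i, A.extend (hp i) (Prod.fst '' W i) with hYdef
  set Z := ⋃ i, A.extend (hq i) (Prod.snd '' W i) with hZdef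
  have hY : ∀ x, A.pos e x ∈ Y ↔ x ∈ Arrow.x '' B₀ := by
    intro x
    simp only [hYdef, mem_iUnion, A.mem_extend_iff, hWO, A.pos_mem_image_fst_iff, B₀, image_iUnion]
    rfl
  have hZ : ∀ x, A.pos e x ∈ Z ↔ x ∈ Arrow.y '' B₀ := by
    intro x
    simp only [hZdef, mem_iUnion, A.mem_extend_iff, hWO, A.pos_mem_image_snd_iff, B₀, image_iUnion]
    rfl
  have hWmem : ∀ i, ∀ β ∈ A.arrows (p i) (q i) (O i), (A.pos (p i) β.x, A.pos (q i) β.y) ∈ W i :=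
    fun i β hβ => (hWO i).symm ▸ A.mem_fibre_of_mem_arrows hβ
  -- Disjointness (LC3) separates different indices, and injectivity (LC2) separates arrows within
  -- one index.
  have hr₀ : InjOn (Arrow.x (A := A)) B₀ := by
    intro β hβ β' hβ' h
    obtain ⟨i, hi⟩ := mem_iUnion.1 hβ
    obtain ⟨j, hj⟩ := mem_iUnion.1 hβ'
    obtain rfl : i = j := by
      by_contra hij
      exact (hdY i j hij).ne_of_mem
        ((A.mem_extend_iff _ β.x).2 ⟨_, hWmem i β hi, rfl⟩)
        ((A.mem_extend_iff _ β'.x).2 ⟨_, hWmem j β' hj, rfl⟩) (congrArg (A.pos e) h)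
    have h' := @(hW i).1 ⟨_, hWmem i β hi⟩ ⟨_, hWmem i β' hj⟩ (congrArg (A.pos (p i)) h)
    have h'' : β.y.1 (q i) = β'.y.1 (q i) := congrArg (fun w : W i => w.1.2.1) h'
    exact Arrow.ext' A h (hi.1.trans hj.1.symm)
      (A.history_eq_of h'' (by rw [← hi.2.1, ← hj.2.1, h]))
  have hs₀ : InjOn (Arrow.y (A := A)) B₀ := by
    intro β hβ β' hβ' h
    obtain ⟨i, hi⟩ := mem_iUnion.1 hβ
    obtain ⟨j, hj⟩ := mem_iUnion.1 hβ'
    obtain rfl : i = j := by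
      by_contra hij
      exact (hdZ i j hij).ne_of_mem
        ((A.mem_extend_iff _ β.y).2 ⟨_, hWmem i β hi, rfl⟩)
        ((A.mem_extend_iff _ β'.y).2 ⟨_, hWmem j β' hj, rfl⟩) (congrArg (A.pos e) h)
    have h' := @(hW i).2.2.1 ⟨_, hWmem i β hi⟩ ⟨_, hWmem i β' hj⟩ (congrArg (A.pos (q i)) h)
    have h'' : β.x.1 (p i) = β'.x.1 (p i) := congrArg (fun w : W i => w.1.1.1) h'
    exact Arrow.ext' A (A.history_eq_of h'' (by rw [hi.2.1, hj.2.1, h]))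
      (hi.1.trans hj.1.symm) h
  have hZS : ∀ x, A.pos e x ∈ Z → A.base x ∈ A.s t '' N := by
    intro x hx
    obtain ⟨β, hβ, rfl⟩ := (hZ x).1 hx
    obtain ⟨i, hi⟩ := mem_iUnion.1 hβ
    obtain ⟨z, hz, h⟩ := hWS i _ (hWmem i β hi)
    have h' : z.1 = A.base β.y := h.trans (A.r_history β.y (q i))
    exact h' ▸ hz
  -- a neighbourhood `V` between `Y` and `Z`
  obtain ⟨m, hmZ, hmY⟩ := exists_of_ssubset hYZ
  obtain ⟨z, rfl⟩ := A.exists_pos_eq m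
  have hZo : IsOpen {x | A.pos e x ∈ Z} := by
    have : {x | A.pos e x ∈ Z} = Arrow.y '' B₀ := ext hZ
    rw [this]
    exact A.isOpenMap_source _ hB₀
  have hYc : IsCompact {x | A.pos e x ∈ closure Y} :=
    (A.isCompact_base_preimage hsK).of_isClosed_subset
      (isClosed_closure.preimage (A.continuous_pos e))
      fun x hx => image_mono hNK (hZS x (hYZ.1 hx))
  -- The point `z` over `Z` but not over the closure of `Y` is kept in the interior of `L`; its lift
  -- will show that the contraction is strict.
  obtain ⟨L, hL, hYL, hLZ⟩ := exists_compact_between (hYc.insert z) hZo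
    (insert_subset hmZ fun x hx => hYZ.1 hx)
  let V : Set A.History := {x | x.1 t ∈ N ∧ A.shift t x ∈ interior L}
  let B : Set A.Arrow := {β | β.x.1 t ∈ N ∧ β.y.1 t ∈ N ∧ A.conj t β ∈ B₀}
  have hVo : IsOpen V := (hN.preimage (A.continuous_history t)).inter
    (isOpen_interior.preimage (A.continuous_shift t))
  have hBo : IsOpen B :=
    (hN.preimage ((A.continuous_history t).comp A.continuous_range)).inter
      ((hN.preimage ((A.continuous_history t).comp A.continuous_source)).inter
        (hB₀.preimage (A.continuous_conj t)))
  have hVL : closure V ⊆ {x | x.1 t ∈ N ∧ A.shift t x ∈ L} := by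
    have h₁ : closure V ⊆ {x | x.1 t ∈ K ∧ A.shift t x ∈ L} :=
      closure_minimal (fun x hx => ⟨hNK hx.1, interior_subset hx.2⟩)
        ((hKc.isClosed.preimage (A.continuous_history t)).inter
          (hL.isClosed.preimage (A.continuous_shift t)))
    -- A limit point has its `t`-coordinate only in `K` at first. Its shift is in `L`, hence based
    -- in `s_t(N)`, and injectivity of `s_t` on `K` brings the coordinate back into `N`.
    intro x hx
    obtain ⟨h, h'⟩ := h₁ hx
    obtain ⟨m, hm, hmx⟩ := hZS _ (hLZ h')
    rw [base_shift] at hmx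
    exact ⟨hinj (hNK hm) h hmx ▸ hm, h'⟩
  refine ⟨V, B, hVo, fun x hx => hNU x hx.1, A.isBisection_iff.2 ⟨hBo, ?_, ?_⟩, ?_, ?_, ?_⟩
  · rintro β ⟨h₁, h₂, h₃⟩ β' ⟨h₁', h₂', h₃'⟩ h
    exact A.eq_of_conj_eq hinjN h₁ h₂ h₁' h₂' (hr₀ h₃ h₃' (congrArg (A.shift t) h))
  · rintro β ⟨h₁, h₂, h₃⟩ β' ⟨h₁', h₂', h₃'⟩ h
    exact A.eq_of_conj_eq hinjN h₁ h₂ h₁' h₂' (hs₀ h₃ h₃' (congrArg (A.shift t) h))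
  · intro x hx
    obtain ⟨h, h'⟩ := hVL hx
    obtain ⟨β, hβ, hβx⟩ := (hZ _).1 (hLZ h')
    obtain ⟨y, hy, hyβ⟩ := hlift β.x
      (hZS _ (hYZ.1 (subset_closure ((hY _).2 ⟨β, hβ, rfl⟩))))
    obtain ⟨α, rfl, rfl, hα⟩ := A.exists_conj_eq t β hyβ hβx.symm
    exact ⟨α, ⟨hy, h, hα ▸ hβ⟩, rfl⟩
  · rintro _ ⟨β, ⟨⟨h₁, h₂, h₃⟩, -⟩, rfl⟩
    exact ⟨h₁, hYL (mem_insert_of_mem _ (subset_closure ((hY _).2 ⟨_, h₃, rfl⟩)))⟩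
  · intro hcon
    obtain ⟨x, hx, rfl⟩ := hlift z (hZS z hmZ)
    obtain ⟨β, ⟨⟨h₁, h₂, h₃⟩, -⟩, rfl⟩ := hcon (show x ∈ V from ⟨hx, hYL (mem_insert _ _)⟩)
    exact hmY (subset_closure ((hY _).2 ⟨_, h₃, rfl⟩))

end CorrAction

theorem mainTheorem12 {P : Type*} [Monoid P] [RightOre P]
    {X : Type*} [TopologicalSpace X] [T2Space X] [LocallyCompactSpace X]
    (A : CorrAction P X) :
    A.transformationGroupoid.LocallyContracting ↔ A.LocallyContracting :=
  ⟨A.locallyContracting_of_groupoid, A.groupoid_locallyContracting⟩
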